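/- **Setting.** All manifolds, maps, actions and sections are smooth and finite dimensional; $V$ is Hausdorff and $\sigma$-compact and $B$ is Hausdorff. *N-anholonomic manifold.* $V$ has dimension $n+m$ and a local fibred structure: $vV\subset TV$ is locally the kernel of the differential of a submersion onto an $n$-dimensional manifold. An N-connection $N:TV\to vV$ is given, i.e. a bundle map which is the identity on $vV$; so $TV=hV\oplus vV$ with $hV=\ker N$. *Lifting bundle gerbe $\Psi$.* Let $k\ge 1$, and let $0\to\mathbb Z_k\to\check G_h\to G_h\to 1$ and $0\to\mathbb Z_k\to\check G_v\to G_v\to 1$ be central extensions of Lie groups (the projections being surjective local diffeomorphisms). Put $\check G=\check G_h\times\check G_v$, $G=G_h\times G_v$ and let $\pi:B\to V$ be a principal $G$-bundle; $\check g\in\check G$ acts on $B$ by $b\mapsto b\,\check g^{-1}$ through $\check G\to G$. *$\Psi^q$-module* ($q\in\mathbb Z$). This is a $\check G$-equivariant complex vector bundle $W\to B$ of finite rank with a $\check G$-invariant decomposition $W=hW\oplus vW$, on which the isotropy group $\mathbb Z_k\times\mathbb Z_k=\ker(\check G\to G)$ has weight $q$: with $\mathbb Z_k\subset U(1)$, an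 element $(z,z')$ acts on $hW$ as $z^q$ and on $vW$ as $z'^q$. The pair of groups $\check G_i^\#=(U(1)\times\check G_i)/\mathbb Z_k$ ($i=h,v$; $\mathbb Z_k$ embedded antidiagonally) acts on $W$, the two factors $U(1)$ acting with weight $q$ on $hW$ and $vW$ respectively. *Module d-connections.* A d-connection on $W$ is a $\mathbb C$-linear connection $D:\omega^0(B,W)\to\omega^1(B,W)$, $D(f\varphi)=df\otimes\varphi+fD\varphi$ for functions $f$ on $B$, which preserves $W=hW\oplus vW$. Fix a $\check G^\#$-equivariant d-connection $\widehat D$ on $W$ along the fibres of $B\to V$ (that is, $\widehat D_\lambda\varphi$ is defined for $\lambda\in\ker d\pi$ only; for instance the natural flat one defined by the $\check G$-action). A $\Psi^q$-module d-connection on $W$ is a $\check G^\#$-equivariant d-connection $D$ on $W$ which is the sum of $\widehat D$ and a part coming from the base, i.e. $D_\lambda=\widehat D_\lambda$ for all $\lambda\in\ker d\pi$. *N-adapted distortions.* Let $\mathcal E(W)=\mathrm{End}(W)/G$, a complex vector bundle over $V=B/G$, where $\mathrm{End}(W)$ denotes endomorphisms preserving $hW\oplus vW$. Let $\omega^1(\mathcal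 E(W))$ be the space of $1$-forms on $V$ with values in $\mathcal E(W)$; each $\theta\in\omega^1(\mathcal E(W))$ has a pull-back $\pi^*\theta\in\omega^1(B,\mathrm{End}(W))$. **Proposition.** The set of $\Psi^q$-module d-connections on $W$ is a (non-empty) affine space with space of translations $\omega^1(\mathcal E(W))$, the translations being $(\theta,D)\mapsto D+\pi^*\theta$. Thus, for $\Psi^q$-module d-connections $D_1,D_2$, there is exactly one $\theta\in\omega^1(\mathcal E(W))$ with $D_1-D_2=\pi^*\theta$, and $D+\pi^*\theta$ is a $\Psi^q$-module d-connection for all $D$ and $\theta$. This affine space is N-distinguished: $\omega^1(\mathcal E(W))$ is the direct sum of the subspace of horizontal forms (vanishing on $vV$) and the subspace of vertical forms (vanishing on $hV$). -/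

import Mathlib

open Set Bundle
open scoped Manifold ContDiff

noncomputable section

namespace DGerbe

/-! ### N-anholonomic manifolds -/

section Base

/-- A nonlinear connection on a locally fibred manifold `V` of dimension `n + m`: the vertical
subbundle `vV` is locally the kernel of the differential of a submersion onto an `n`-dimensional
base, and `N : TV → vV` is a smooth bundle map which is the identity on `vV`.  It is recorded as a
field of idempotents of `TV` with range `vV`; the horizontal subbundle is `hV = ker N`, so that
`TV = hV ⊕ vV`. -/
structure NConnection (n m : ℕ) (V : Type*) [TopologicalSpace V]
    [ChartedSpace (EuclideanSpace ℝ (Fin (n + m))) V] [IsManifold (𝓡 (n + m)) ∞ V] where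
  N : ∀ x : V, TangentSpace (𝓡 (n + m)) x →ₗ[ℝ] TangentSpace (𝓡 (n + m)) x
  idem : ∀ (x : V) (X : TangentSpace (𝓡 (n + m)) x), N x (N x X) = N x X
  smooth : ∀ X : Cₛ^∞⟮𝓡 (n + m); EuclideanSpace ℝ (Fin (n + m)),
      (TangentSpace (𝓡 (n + m)) : V → Type _)⟯,
    ContMDiff (𝓡 (n + m)) ((𝓡 (n + m)).prod 𝓘(ℝ, EuclideanSpace ℝ (Fin (n + m)))) ∞
      (fun x => TotalSpace.mk' (EuclideanSpace ℝ (Fin (n + m)))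
        (E := (TangentSpace (𝓡 (n + m)) : V → Type _)) x (N x (X x)))
  fibred : ∀ x : V, ∃ (U : Set V) (f : V → EuclideanSpace ℝ (Fin n)), IsOpen U ∧ x ∈ U ∧
    ContMDiffOn (𝓡 (n + m)) (𝓡 n) ∞ f U ∧
    ∀ y ∈ U, Function.Surjective (mfderiv (𝓡 (n + m)) (𝓡 n) f y) ∧
      ∀ X : TangentSpace (𝓡 (n + m)) y,
        mfderiv (𝓡 (n + m)) (𝓡 n) f y X = 0 ↔ X ∈ LinearMap.range (N y)

end Base

/-! ### Central extensions and principal bundles -/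

/-- A central extension of Lie groups `0 → ℤ_k → Gc → G → 1`, with `Gc → G` a smooth covering. -/
structure CentralExt (k : ℕ) (E : Type*) [NormedAddCommGroup E] [NormedSpace ℝ E]
    (Gc G : Type*) [Group Gc] [TopologicalSpace Gc] [ChartedSpace E Gc]
    [Group G] [TopologicalSpace G] [ChartedSpace E G] where
  incl : Multiplicative (ZMod k) →* Gc
  proj : Gc →* G
  incl_injective : Function.Injective incl
  proj_surjective : Function.Surjective proj
  exact : ∀ g : Gc, proj g = 1 ↔ g ∈ MonoidHom.range incl
  central : ∀ (z : Multiplicative (ZMod k)) (g : Gc), incl z * g = g * incl z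
  localDiffeo : IsLocalDiffeomorph 𝓘(ℝ, E) 𝓘(ℝ, E) ∞ proj

section Gerbe

variable (k n m : ℕ) (V : Type*) [TopologicalSpace V]
  [ChartedSpace (EuclideanSpace ℝ (Fin (n + m))) V]
  (EB : Type*) [NormedAddCommGroup EB] [NormedSpace ℝ EB]
  (B : Type*) [TopologicalSpace B] [ChartedSpace EB B]
  (Eh : Type*) [NormedAddCommGroup Eh] [NormedSpace ℝ Eh]
  (Ev : Type*) [NormedAddCommGroup Ev] [NormedSpace ℝ Ev]
  (Gh Gv Gch Gcv : Type*)
  [Group Gh] [TopologicalSpace Gh] [ChartedSpace Eh Gh]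
  [Group Gv] [TopologicalSpace Gv] [ChartedSpace Ev Gv]
  [Group Gch] [TopologicalSpace Gch] [ChartedSpace Eh Gch]
  [Group Gcv] [TopologicalSpace Gcv] [ChartedSpace Ev Gcv]

/-- The data of a lifting bundle gerbe `Ψ`: a smooth (right) principal bundle `B → V` for the Lie
d-group `G = (Gh, Gv)`, and a central extension of d-groups of `G` by `ℤ_k`, that is, a central
extension of each of the two components. -/
structure LiftingGerbe where
  extH : CentralExt k Eh Gch Gh
  extV : CentralExt k Ev Gcv Gv
  proj : B → V
  rightAct : B → Gh × Gv → B
  proj_smooth : ContMDiff 𝓘(ℝ, EB) (𝓡 (n + m)) ∞ proj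
  rightAct_smooth : ContMDiff (𝓘(ℝ, EB).prod (𝓘(ℝ, Eh).prod 𝓘(ℝ, Ev))) 𝓘(ℝ, EB) ∞
    (fun p : B × (Gh × Gv) => rightAct p.1 p.2)
  rightAct_one : ∀ b, rightAct b 1 = b
  rightAct_mul : ∀ b g g', rightAct b (g * g') = rightAct (rightAct b g) g'
  localTriv : ∀ x : V, ∃ e : Trivialization (Gh × Gv) proj, x ∈ e.baseSet ∧
    ContMDiffOn 𝓘(ℝ, EB) ((𝓡 (n + m)).prod (𝓘(ℝ, Eh).prod 𝓘(ℝ, Ev))) ∞ e e.source ∧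
    ContMDiffOn ((𝓡 (n + m)).prod (𝓘(ℝ, Eh).prod 𝓘(ℝ, Ev))) 𝓘(ℝ, EB) ∞
      e.toOpenPartialHomeomorph.symm e.target ∧
    ∀ b, proj b ∈ e.baseSet → ∀ g, proj (rightAct b g) = proj b ∧
      e (rightAct b g) = ((e b).1, (e b).2 * g)

end Gerbe

section Main

variable {k n m : ℕ} {V : Type*} [TopologicalSpace V]
  [ChartedSpace (EuclideanSpace ℝ (Fin (n + m))) V]
  {EB : Type*} [NormedAddCommGroup EB] [NormedSpace ℝ EB]
  {B : Type*} [TopologicalSpace B] [ChartedSpace EB B]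
  {Eh : Type*} [NormedAddCommGroup Eh] [NormedSpace ℝ Eh]
  {Ev : Type*} [NormedAddCommGroup Ev] [NormedSpace ℝ Ev]
  {Gh Gv Gch Gcv : Type*}
  [Group Gh] [TopologicalSpace Gh] [ChartedSpace Eh Gh]
  [Group Gv] [TopologicalSpace Gv] [ChartedSpace Ev Gv]
  [Group Gch] [TopologicalSpace Gch] [ChartedSpace Eh Gch]
  [Group Gcv] [TopologicalSpace Gcv] [ChartedSpace Ev Gcv]

namespace LiftingGerbe

variable (L : LiftingGerbe k n m V EB B Eh Ev Gh Gv Gch Gcv)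

/-- The covering homomorphism of d-groups `Gc = (Gch, Gcv) → G = (Gh, Gv)`. -/
def cov : Gch × Gcv →* Gh × Gv := MonoidHom.prodMap L.extH.proj L.extV.proj

/-- The inclusion of the kernel of `Gc → G`, one copy of `ℤ_k` for each component. -/
def ker (z z' : ZMod k) : Gch × Gcv :=
  (L.extH.incl (Multiplicative.ofAdd z), L.extV.incl (Multiplicative.ofAdd z'))

/-- The left action of the extended d-group on `B`: `g · b = b g⁻¹`. -/
def lact (g : Gch × Gcv) (b : B) : B := L.rightAct b (L.cov g)⁻¹

theorem lact_one (b : B) : L.lact 1 b = b := by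
  simp [lact, L.rightAct_one]

theorem lact_mul (g h : Gch × Gcv) (b : B) : L.lact (g * h) b = L.lact g (L.lact h b) := by
  simp [lact, ← L.rightAct_mul]

theorem proj_lact (g : Gch × Gcv) (b : B) : L.proj (L.lact g b) = L.proj b := by
  obtain ⟨e, he, -, -, h⟩ := L.localTriv (L.proj b)
  exact (h b he _).1

theorem exists_lact {b b' : B} (h : L.proj b = L.proj b') : ∃ g, L.lact g b = b' := by
  obtain ⟨e, he, -, -, H⟩ := L.localTriv (L.proj b)
  have hb : b ∈ e.source := e.mem_source.2 he
  have hb' : b' ∈ e.source := e.mem_source.2 (h ▸ he)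
  obtain ⟨g1, h1⟩ := L.extH.proj_surjective ((e b).2⁻¹ * (e b').2)⁻¹.1
  obtain ⟨g2, h2⟩ := L.extV.proj_surjective ((e b).2⁻¹ * (e b').2)⁻¹.2
  have hg : L.cov (g1, g2) = ((e b).2⁻¹ * (e b').2)⁻¹ := Prod.ext h1 h2
  refine ⟨(g1, g2), ?_⟩
  obtain ⟨H1, H2⟩ := H b he (L.cov (g1, g2))⁻¹
  refine e.injOn (e.mem_source.2 (by rw [proj_lact]; exact he)) hb' ?_
  have H2' : e (L.lact (g1, g2) b) = ((e b).1, (e b).2 * (L.cov (g1, g2))⁻¹) := H2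
  refine H2'.trans ?_
  rw [hg]
  refine Prod.ext ?_ ?_
  · exact (e.coe_fst hb).trans (h.trans (e.coe_fst hb').symm)
  · simp

theorem lact_eq_self {g : Gch × Gcv} {b : B} (h : L.lact g b = b) :
    ∃ z z' : ZMod k, g = L.ker z z' := by
  obtain ⟨e, he, -, -, H⟩ := L.localTriv (L.proj b)
  obtain ⟨H1, H2⟩ := H b he (L.cov g)⁻¹
  have H2' : e (L.lact g b) = ((e b).1, (e b).2 * (L.cov g)⁻¹) := H2
  rw [h] at H2'
  have h3 : L.cov g = 1 := by
    have := congrArg Prod.snd H2'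
    simpa using this
  obtain ⟨z, hz⟩ := (L.extH.exact g.1).1 (congrArg Prod.fst h3)
  obtain ⟨z', hz'⟩ := (L.extV.exact g.2).1 (congrArg Prod.snd h3)
  exact ⟨z.toAdd, z'.toAdd, Prod.ext hz.symm hz'.symm⟩

theorem exists_point (x : V) : ∃ b, L.proj b = x := by
  obtain ⟨e, he, -⟩ := L.localTriv x
  exact ⟨e.toOpenPartialHomeomorph.symm (x, 1), e.proj_symm_apply' he⟩

end LiftingGerbe

variable {F : Type*} [NormedAddCommGroup F] [NormedSpace ℂ F]
  {W : B → Type*} [∀ b, AddCommGroup (W b)] [∀ b, Module ℂ (W b)] [∀ b, TopologicalSpace (W b)]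
  [TopologicalSpace (TotalSpace F W)] [FiberBundle F W]

variable (EB F) in
/-- A section of `W → B` is smooth. -/
def SmoothSec (s : ∀ b, W b) : Prop :=
  ContMDiff 𝓘(ℝ, EB) (𝓘(ℝ, EB).prod 𝓘(ℝ, F)) ∞ (fun b => TotalSpace.mk' F b (s b))

/-- Smooth vector fields on `B`. -/
abbrev VField (EB B : Type*) [NormedAddCommGroup EB] [NormedSpace ℝ EB] [TopologicalSpace B]
    [ChartedSpace EB B] [IsManifold 𝓘(ℝ, EB) ∞ B] :=
  Cₛ^∞⟮𝓘(ℝ, EB); EB, (TangentSpace 𝓘(ℝ, EB) : B → Type _)⟯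

theorem smoothSec_smul [IsManifold 𝓘(ℝ, EB) ∞ B] [VectorBundle ℂ F W] [VectorBundle ℝ F W]
    [ContMDiffVectorBundle ∞ F W 𝓘(ℝ, EB)] (c : ℂ) {s : ∀ b, W b} (hs : SmoothSec EB F s) :
    SmoothSec EB F (fun b => c • s b) := by
  intro b₀
  have h := (contMDiffAt_section b₀).1 (hs b₀)
  refine (contMDiffAt_section b₀).2 ?_
  have h2 : ContMDiffAt 𝓘(ℝ, EB) 𝓘(ℝ, F) ∞
      (fun b => c • (trivializationAt F W b₀ ⟨b, s b⟩).2) b₀ :=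
    ((c • ContinuousLinearMap.id ℝ F).contMDiff.contMDiffAt).comp b₀ h
  refine h2.congr_of_eventuallyEq ?_
  filter_upwards [(trivializationAt F W b₀).open_baseSet.mem_nhds
    (mem_baseSet_trivializationAt F W b₀)] with b hb
  exact ((trivializationAt F W b₀).linear ℂ hb).map_smul c (s b)

/-- The differential of a complex valued function on `B`. -/
def cdiff (f : B → ℂ) (b : B) (X : TangentSpace 𝓘(ℝ, EB) b) : ℂ :=
  mfderiv 𝓘(ℝ, EB) 𝓘(ℝ, ℂ) f b X

section PsiModule

variable [NeZero k] (L : LiftingGerbe k n m V EB B Eh Ev Gh Gv Gch Gcv)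

variable (F W) in
/-- A `Ψ^q`-module: an equivariant bundle `W → B` for the extended d-group `Gc`, with an invariant
smooth Whitney sum decomposition `W = hW ⊕ vW` (given by the projection onto `hW` along `vW`), on
which the isotropy d-group `ℤ_k × ℤ_k` acts with weight `q`: its first factor acts on `hW` by the
`q`-th power of the character `ℤ_k ⊂ U(1)` and trivially on `vW`, its second factor acts on `vW` in
this way and trivially on `hW`. -/
structure PsiModule (q : ℤ) where
  act : ∀ (g : Gch × Gcv) (b : B), W b ≃ₗ[ℂ] W (L.lact g b)
  act_one : ∀ b w, TotalSpace.mk' F (L.lact 1 b) (act 1 b w) = TotalSpace.mk' F b w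
  act_mul : ∀ g h b w, TotalSpace.mk' F (L.lact (g * h) b) (act (g * h) b w) =
    TotalSpace.mk' F (L.lact g (L.lact h b)) (act g (L.lact h b) (act h b w))
  act_smooth : ContMDiff ((𝓘(ℝ, Eh).prod 𝓘(ℝ, Ev)).prod (𝓘(ℝ, EB).prod 𝓘(ℝ, F)))
    (𝓘(ℝ, EB).prod 𝓘(ℝ, F)) ∞ (fun p : (Gch × Gcv) × TotalSpace F W =>
      TotalSpace.mk' F (L.lact p.1 p.2.proj) (act p.1 p.2.proj p.2.snd))
  hProj : ∀ b, W b →ₗ[ℂ] W b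
  hProj_idem : ∀ b w, hProj b (hProj b w) = hProj b w
  hProj_smooth : ∀ s : ∀ b, W b, SmoothSec EB F s → SmoothSec EB F (fun b => hProj b (s b))
  hProj_act : ∀ g b w, hProj (L.lact g b) (act g b w) = act g b (hProj b w)
  weight_h : ∀ (z z' : ZMod k) b w, hProj b w = w →
    TotalSpace.mk' F (L.lact (L.ker z z') b) (act (L.ker z z') b w) =
      TotalSpace.mk' F b (((ZMod.toCircle z ^ q : Circle) : ℂ) • w)
  weight_v : ∀ (z z' : ZMod k) b w, hProj b w = 0 →
    TotalSpace.mk' F (L.lact (L.ker z z') b) (act (L.ker z z') b w) =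
      TotalSpace.mk' F b (((ZMod.toCircle z' ^ q : Circle) : ℂ) • w)

end PsiModule

namespace PsiModule

variable [NeZero k] {L : LiftingGerbe k n m V EB B Eh Ev Gh Gv Gch Gcv} {q : ℤ}
  (M : PsiModule F W L q)

/-! ### The bundle `𝓔(W) = End(W)/G` over `V` -/

/-- N-adapted endomorphisms of `W_b`: those preserving `W_b = hW_b ⊕ vW_b`. -/
def EndN (b : B) : Submodule ℂ (W b →ₗ[ℂ] W b) where
  carrier := {A | ∀ w, A (M.hProj b w) = M.hProj b (A w)}
  add_mem' := by
    intro A A' h h' w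
    simp [h w, h' w]
  zero_mem' := by
    intro w
    simp
  smul_mem' := by
    intro c A h w
    simp [h w]

/-- The action of `g` on endomorphisms by conjugation. -/
def conj (g : Gch × Gcv) (b : B) : M.EndN b →ₗ[ℂ] M.EndN (L.lact g b) where
  toFun A := ⟨(M.act g b).conj A.1, fun w => by
    obtain ⟨w, rfl⟩ := (M.act g b).surjective w
    simp [LinearEquiv.conj_apply, M.hProj_act, A.2 w]⟩
  map_add' A A' := by
    ext w
    simp
  map_smul' c A := by
    ext w
    simp

theorem conj_act (g : Gch × Gcv) (b : B) (A : M.EndN b) (w : W b) :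
    (M.conj g b A).1 (M.act g b w) = M.act g b (A.1 w) := by
  simp [conj, LinearEquiv.conj_apply]

theorem sigma_ext {b b₁ b₂ : B} (φ : W b ≃ₗ[ℂ] W b₁) (ψ : W b ≃ₗ[ℂ] W b₂)
    (hb : b₁ = b₂) (h : ∀ w, TotalSpace.mk' F b₁ (φ w) = TotalSpace.mk' F b₂ (ψ w))
    (A₁ : M.EndN b₁) (A₂ : M.EndN b₂)
    (hA : ∀ w, TotalSpace.mk' F b₁ (A₁.1 (φ w)) = TotalSpace.mk' F b₂ (A₂.1 (ψ w))) :
    (⟨b₁, A₁⟩ : Σ b, M.EndN b) = ⟨b₂, A₂⟩ := by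
  subst hb
  congr 1
  ext w
  obtain ⟨w, rfl⟩ := φ.surjective w
  have h1 : φ w = ψ w := TotalSpace.mk_inj.1 (h w)
  have h2 := TotalSpace.mk_inj.1 (hA w)
  rw [h2, h1]

theorem conj_one (b : B) (A : M.EndN b) :
    (⟨L.lact 1 b, M.conj 1 b A⟩ : Σ b, M.EndN b) = ⟨b, A⟩ :=
  M.sigma_ext (M.act 1 b) (LinearEquiv.refl ℂ _) (L.lact_one b) (M.act_one b) _ _ fun w => by
    rw [conj_act]
    exact M.act_one b _

theorem conj_mul (g h : Gch × Gcv) (b : B) (A : M.EndN b) :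
    (⟨L.lact (g * h) b, M.conj (g * h) b A⟩ : Σ b, M.EndN b) =
      ⟨L.lact g (L.lact h b), M.conj g _ (M.conj h b A)⟩ :=
  M.sigma_ext (M.act (g * h) b) ((M.act h b).trans (M.act g _)) (L.lact_mul g h b)
    (M.act_mul g h b) _ _ fun w => by
      simp only [LinearEquiv.trans_apply, conj_act]
      exact M.act_mul g h b _

/-- Scalar action of the isotropy d-group on the two summands. -/
theorem act_ker (z z' : ZMod k) (b : B) (w : W b) :
    TotalSpace.mk' F (L.lact (L.ker z z') b) (M.act (L.ker z z') b w) =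
      TotalSpace.mk' F b (((ZMod.toCircle z ^ q : Circle) : ℂ) • M.hProj b w +
        ((ZMod.toCircle z' ^ q : Circle) : ℂ) • (w - M.hProj b w)) := by
  have key : ∀ (b' : B) (_ : b' = b) (φ : W b ≃ₗ[ℂ] W b') (c c' : ℂ)
      (_ : ∀ w, M.hProj b w = w → TotalSpace.mk' F b' (φ w) = TotalSpace.mk' F b (c • w))
      (_ : ∀ w, M.hProj b w = 0 → TotalSpace.mk' F b' (φ w) = TotalSpace.mk' F b (c' • w)),
      TotalSpace.mk' F b' (φ w) =
        TotalSpace.mk' F b (c • M.hProj b w + c' • (w - M.hProj b w)) := by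
    intro b' hb φ c c' h1 h2
    subst hb
    have e1 := TotalSpace.mk_inj.1 (h1 (M.hProj b' w) (M.hProj_idem b' w))
    have e2 := TotalSpace.mk_inj.1 (h2 (w - M.hProj b' w) (by simp [M.hProj_idem]))
    rw [← e1, ← e2, ← map_add]
    simp
  have hb : L.lact (L.ker z z') b = b := by
    have h1 : L.extH.proj (L.extH.incl (Multiplicative.ofAdd z)) = 1 :=
      (L.extH.exact _).2 ⟨_, rfl⟩
    have h2 : L.extV.proj (L.extV.incl (Multiplicative.ofAdd z')) = 1 :=
      (L.extV.exact _).2 ⟨_, rfl⟩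
    have : L.cov (L.ker z z') = 1 := Prod.ext h1 h2
    simp [LiftingGerbe.lact, this, L.rightAct_one]
  exact key _ hb _ _ _ (M.weight_h z z' b) (M.weight_v z z' b)

/-- The action on `W` of the pair of groups `(U(1) × Gc)/ℤ_k` (one for each component), written on
representatives: `U(1)` acts with weight `q` on the corresponding summand. -/
def sharpAct (c : Circle × Circle) (g : Gch × Gcv) (b : B) (w : W b) : W (L.lact g b) :=
  M.act g b (((c.1 ^ q : Circle) : ℂ) • M.hProj b w +
    ((c.2 ^ q : Circle) : ℂ) • (w - M.hProj b w))

/-- The antidiagonal copies of `ℤ_k` in `U(1) × Gc` act trivially. -/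
theorem sharpAct_antidiagonal (z z' : ZMod k) (b : B) (w : W b) :
    TotalSpace.mk' F (L.lact (L.ker z z') b)
      (M.sharpAct ((ZMod.toCircle z)⁻¹, (ZMod.toCircle z')⁻¹) (L.ker z z') b w) =
      TotalSpace.mk' F b w := by
  rw [sharpAct, M.act_ker]
  congr 1
  have h : ∀ c : Circle, (c : ℂ) ^ q * ((c : ℂ) ^ q)⁻¹ = 1 := fun c =>
    mul_inv_cancel₀ (zpow_ne_zero _ c.coe_ne_zero)
  simp [M.hProj_idem, smul_smul, h]

/-- Two N-adapted endomorphisms of fibres of `W` over the fibre of `B` at `x` are equivalent if the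
extended d-group (equivalently `G`, as the kernel acts trivially on endomorphisms) carries one
into the other. -/
def adSetoid (x : V) : Setoid (Σ b : {b : B // L.proj b = x}, M.EndN b.1) where
  r p p' := ∃ g, (⟨L.lact g p.1.1, M.conj g p.1.1 p.2⟩ : Σ b, M.EndN b) = ⟨p'.1.1, p'.2⟩
  iseqv := by
    refine ⟨fun p => ⟨1, M.conj_one _ _⟩, ?_, ?_⟩
    · rintro ⟨⟨b, hb⟩, A⟩ ⟨⟨b', hb'⟩, A'⟩ ⟨g, hg⟩
      refine ⟨g⁻¹, ?_⟩
      have := M.conj_mul g⁻¹ g b A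
      rw [inv_mul_cancel, M.conj_one] at this
      rw [this]
      exact (congrArg (fun p : Σ b, M.EndN b =>
        (⟨L.lact g⁻¹ p.1, M.conj g⁻¹ p.1 p.2⟩ : Σ b, M.EndN b)) hg).symm
    · rintro ⟨⟨b, hb⟩, A⟩ ⟨⟨b', hb'⟩, A'⟩ ⟨⟨b'', hb''⟩, A''⟩ ⟨g, hg⟩ ⟨h, hh⟩
      refine ⟨h * g, ?_⟩
      rw [M.conj_mul]
      exact (congrArg (fun p : Σ b, M.EndN b =>
        (⟨L.lact h p.1, M.conj h p.1 p.2⟩ : Σ b, M.EndN b)) hg).trans hh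

/-- The fibre at `x` of the bundle `𝓔(W) = End(W)/G` over `V`. -/
def AdFiber (x : V) : Type _ := Quotient (M.adSetoid x)

/-- The class in `𝓔(W)` of an N-adapted endomorphism of `W_b`. -/
def adMk {x : V} (b : B) (hb : L.proj b = x) (A : M.EndN b) : M.AdFiber x :=
  Quotient.mk (M.adSetoid x) ⟨⟨b, hb⟩, A⟩

theorem adMk_conj {x : V} (b : B) (hb : L.proj b = x) (g : Gch × Gcv) (A : M.EndN b) :
    M.adMk (L.lact g b) ((L.proj_lact g b).trans hb) (M.conj g b A) = M.adMk b hb A :=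
  (Quotient.sound (s := M.adSetoid x) ⟨g, rfl⟩).symm

theorem adMk_bijective {x : V} (b : B) (hb : L.proj b = x) :
    Function.Bijective (M.adMk b hb) := by
  constructor
  · intro A A' h
    obtain ⟨g, hg⟩ := Quotient.exact (s := M.adSetoid x) h
    have hg1 : L.lact g b = b := congrArg Sigma.fst hg
    obtain ⟨z, z', rfl⟩ := L.lact_eq_self hg1
    have key : (⟨L.lact (L.ker z z') b, M.conj (L.ker z z') b A⟩ : Σ b, M.EndN b) = ⟨b, A⟩ := by
      have hne : ∀ c : Circle, (c : ℂ) ≠ 0 := fun c => c.coe_ne_zero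
      have key2 : ∀ (b' : B) (_ : b' = b) (φ : W b ≃ₗ[ℂ] W b') (c c' : ℂ) (A₁ : M.EndN b')
          (_ : ∀ w, TotalSpace.mk' F b' (φ w) =
            TotalSpace.mk' F b (c • M.hProj b w + c' • (w - M.hProj b w)))
          (_ : ∀ w, A₁.1 (φ w) = φ (A.1 w)),
          (⟨b', A₁⟩ : Σ b, M.EndN b) = ⟨b, A⟩ := by
        intro b' hb' φ c c' A₁ h1 h2
        subst hb'
        congr 1
        ext w
        obtain ⟨w, rfl⟩ := φ.surjective w
        have e : ∀ w, φ w = c • M.hProj b' w + c' • (w - M.hProj b' w) :=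
          fun w => TotalSpace.mk_inj.1 (h1 w)
        rw [h2, e, e]
        simp [A.2 w]
      exact key2 _ hg1 _ _ _ _ (M.act_ker z z' b) (M.conj_act _ b A)
    have h2 := key.symm.trans hg
    simpa using h2
  · intro y
    induction y using Quotient.inductionOn with
    | _ p =>
      obtain ⟨⟨b', hb'⟩, A'⟩ := p
      obtain ⟨g, hg⟩ := L.exists_lact (hb'.trans hb.symm)
      subst hg
      exact ⟨M.conj g b' A', M.adMk_conj b' hb' g A'⟩

/-- A chosen identification of the fibre `𝓔(W)_x` with N-adapted endomorphisms; it is only used to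
transport the vector space structure, which does not depend on it (see `adIso`). -/
def adEquiv₀ (x : V) : M.EndN (L.exists_point x).choose ≃ M.AdFiber x :=
  Equiv.ofBijective _ (M.adMk_bijective _ (L.exists_point x).choose_spec)

instance (x : V) : AddCommGroup (M.AdFiber x) := (M.adEquiv₀ x).symm.addCommGroup

instance (x : V) : Module ℂ (M.AdFiber x) := (M.adEquiv₀ x).symm.module ℂ

theorem adMk_linear₀ (x : V) (b : B) (hb : L.proj b = x) :
    (∀ A A' : M.EndN b, M.adMk b hb (A + A') = M.adMk b hb A + M.adMk b hb A') ∧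
      ∀ (c : ℂ) (A : M.EndN b), M.adMk b hb (c • A) = c • M.adMk b hb A := by
  have hb₀ : L.proj (L.exists_point x).choose = x := (L.exists_point x).choose_spec
  have hadd : ∀ A A' : M.EndN (L.exists_point x).choose,
      M.adMk _ hb₀ (A + A') = M.adMk _ hb₀ A + M.adMk _ hb₀ A' := fun A A' => by
    change M.adEquiv₀ x (A + A') =
      M.adEquiv₀ x ((M.adEquiv₀ x).symm (M.adEquiv₀ x A) + (M.adEquiv₀ x).symm (M.adEquiv₀ x A'))
    simp
  have hsmul : ∀ (c : ℂ) (A : M.EndN (L.exists_point x).choose),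
      M.adMk _ hb₀ (c • A) = c • M.adMk _ hb₀ A := fun c A => by
    change M.adEquiv₀ x (c • A) = M.adEquiv₀ x (c • (M.adEquiv₀ x).symm (M.adEquiv₀ x A))
    simp
  obtain ⟨g, hg⟩ := L.exists_lact (hb.trans hb₀.symm)
  generalize hy : (L.exists_point x).choose = b₀ at *
  subst hg
  constructor
  · intro A A'
    have := hadd (M.conj g b A) (M.conj g b A')
    rwa [← map_add, M.adMk_conj b hb, M.adMk_conj b hb, M.adMk_conj b hb] at this
  · intro c A
    have := hsmul c (M.conj g b A)
    rwa [← map_smul, M.adMk_conj b hb, M.adMk_conj b hb] at this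

/-- Taking classes is a linear isomorphism from the N-adapted endomorphisms of `W_b` onto the fibre
of `𝓔(W)`, for every point `b` over `x`. -/
def adIso {x : V} (b : B) (hb : L.proj b = x) : M.EndN b ≃ₗ[ℂ] M.AdFiber x :=
  LinearEquiv.ofBijective
    { toFun := M.adMk b hb
      map_add' := (M.adMk_linear₀ x b hb).1
      map_smul' := (M.adMk_linear₀ x b hb).2 }
    (M.adMk_bijective b hb)

/-! ### One-forms with values in `𝓔(W)` -/

/-- The pull-back to `B` of a (not necessarily smooth) one-form on `V` with values in `𝓔(W)`, as a
one-form on `B` with values in the N-adapted endomorphisms of `W`. -/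
def pullback (θ : ∀ x : V, TangentSpace (𝓡 (n + m)) x →ₗ[ℝ] M.AdFiber x) (b : B)
    (X : TangentSpace 𝓘(ℝ, EB) b) : M.EndN b :=
  (M.adIso b rfl).symm (θ (L.proj b) (mfderiv 𝓘(ℝ, EB) (𝓡 (n + m)) L.proj b X))

variable [IsManifold 𝓘(ℝ, EB) ∞ B] [VectorBundle ℂ F W] [VectorBundle ℝ F W]
  [ContMDiffVectorBundle ∞ F W 𝓘(ℝ, EB)]

/-- The space `ω¹(𝓔(W))` of smooth one-forms on `V` with values in `𝓔(W) = End(W)/G`.  Since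
`End(W) → 𝓔(W)` covers the surjective submersion `B → V` and is an isomorphism on fibres, such a
form is smooth if and only if its pull-back to `B` is a smooth form with values in `End(W)`, that is,
if it gives a smooth section when evaluated on smooth vector fields and smooth sections. -/
def AdForms : Submodule ℂ (∀ x : V, TangentSpace (𝓡 (n + m)) x →ₗ[ℝ] M.AdFiber x) where
  carrier := {θ | ∀ (X : VField EB B) (s : Cₛ^∞⟮𝓘(ℝ, EB); F, W⟯),
    SmoothSec EB F (fun b => (M.pullback θ b (X b)).1 (s b))}
  add_mem' := by
    intro θ θ' h h' X s
    have := (h X s).add_section (h' X s)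
    simpa [SmoothSec, pullback] using this
  zero_mem' := by
    intro X s
    have := (Bundle.contMDiff_zeroSection ℝ W : ContMDiff 𝓘(ℝ, EB) (𝓘(ℝ, EB).prod 𝓘(ℝ, F)) ∞ _)
    simp only [SmoothSec, pullback, Pi.zero_apply, LinearMap.zero_apply, map_zero,
      ZeroMemClass.coe_zero]
    exact this
  smul_mem' := by
    intro c θ h X s
    have := smoothSec_smul c (h X s)
    simpa [SmoothSec, pullback] using this

/-- The horizontal forms: those vanishing on `vV`. -/
def hForms [IsManifold (𝓡 (n + m)) ∞ V] (N : NConnection n m V) : Submodule ℂ M.AdForms where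
  carrier := {θ | ∀ x X, θ.1 x (N.N x X) = 0}
  add_mem' := by
    intro θ θ' h h' x X
    simp [h x X, h' x X]
  zero_mem' := by
    intro x X
    simp
  smul_mem' := by
    intro c θ h x X
    simp [h x X]

/-- The vertical forms: those vanishing on `hV = ker N`. -/
def vForms [IsManifold (𝓡 (n + m)) ∞ V] (N : NConnection n m V) : Submodule ℂ M.AdForms where
  carrier := {θ | ∀ x X, N.N x X = 0 → θ.1 x X = 0}
  add_mem' := by
    intro θ θ' h h' x X hX
    simp [h x X hX, h' x X hX]
  zero_mem' := by
    intro x X hX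
    simp
  smul_mem' := by
    intro c θ h x X hX
    simp [h x X hX]

/-! ### Module d-connections -/

/-- A d-connection on `W → B`: an operator from smooth sections of `W` to smooth `W`-valued
one-forms on `B`, additive, satisfying the Leibniz rule (for complex valued functions, so that it is
complex linear), and preserving the decomposition `W = hW ⊕ vW`. -/
structure DConnection where
  toFun : Cₛ^∞⟮𝓘(ℝ, EB); F, W⟯ → ∀ b : B, TangentSpace 𝓘(ℝ, EB) b →ₗ[ℝ] W b
  smooth : ∀ s (X : VField EB B), SmoothSec EB F (fun b => toFun s b (X b))
  add : ∀ s t b X, toFun (s + t) b X = toFun s b X + toFun t b X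
  leibniz : ∀ (f : C^∞⟮𝓘(ℝ, EB), B; 𝓘(ℝ, ℂ), ℂ⟯) (s t : Cₛ^∞⟮𝓘(ℝ, EB); F, W⟯),
    (∀ b, t b = f b • s b) → ∀ b X,
      toFun t b X = cdiff f b X • s b + f b • toFun s b X
  adapted : ∀ s t : Cₛ^∞⟮𝓘(ℝ, EB); F, W⟯, (∀ b, t b = M.hProj b (s b)) →
    ∀ b X, toFun t b X = M.hProj b (toFun s b X)

/-- Vectors tangent to the fibres of `B → V`. -/
abbrev FibreTangent (L : LiftingGerbe k n m V EB B Eh Ev Gh Gv Gch Gcv) (b : B) :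
    Submodule ℝ (TangentSpace 𝓘(ℝ, EB) b) :=
  LinearMap.ker (mfderiv 𝓘(ℝ, EB) (𝓡 (n + m)) L.proj b).toLinearMap

/-- An equivariant d-connection along the fibres of `B → V`: a d-connection on `W` differentiating
only in the directions tangent to the fibres.  (An example is the natural flat one, whose parallel
sections along the fibres are the locally `Gc`-invariant ones.) -/
structure FibreDConnection where
  toFun : Cₛ^∞⟮𝓘(ℝ, EB); F, W⟯ → ∀ b : B, FibreTangent L b →ₗ[ℝ] W b
  smooth : ∀ s (X : VField EB B) (hX : ∀ b, X b ∈ FibreTangent L b),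
    SmoothSec EB F (fun b => toFun s b ⟨X b, hX b⟩)
  add : ∀ s t b X, toFun (s + t) b X = toFun s b X + toFun t b X
  leibniz : ∀ (f : C^∞⟮𝓘(ℝ, EB), B; 𝓘(ℝ, ℂ), ℂ⟯) (s t : Cₛ^∞⟮𝓘(ℝ, EB); F, W⟯),
    (∀ b, t b = f b • s b) → ∀ b X,
      toFun t b X = cdiff f b X.1 • s b + f b • toFun s b X
  adapted : ∀ s t : Cₛ^∞⟮𝓘(ℝ, EB); F, W⟯, (∀ b, t b = M.hProj b (s b)) →
    ∀ b X, toFun t b X = M.hProj b (toFun s b X)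
  equivariant : ∀ (c : Circle × Circle) (g : Gch × Gcv) (s t : Cₛ^∞⟮𝓘(ℝ, EB); F, W⟯),
    (∀ b, t (L.lact g b) = M.sharpAct c g b (s b)) →
    ∀ b (X : FibreTangent L b) (Y : FibreTangent L (L.lact g b)),
      Y.1 = mfderiv 𝓘(ℝ, EB) 𝓘(ℝ, EB) (L.lact g) b X.1 →
      toFun t (L.lact g b) Y = M.sharpAct c g b (toFun s b X)

/-- A `Ψ^q`-module d-connection: a d-connection on `W` which is equivariant for
`(U(1) × Gc)/ℤ_k`, and which is the sum of the given d-connection `D₀` along the fibres of `B → V`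
and a part coming from the base, i.e. it coincides with `D₀` on vectors tangent to the fibres. -/
structure ModuleDConnection (D₀ : M.FibreDConnection) extends M.DConnection where
  equivariant : ∀ (c : Circle × Circle) (g : Gch × Gcv) (s t : Cₛ^∞⟮𝓘(ℝ, EB); F, W⟯),
    (∀ b, t (L.lact g b) = M.sharpAct c g b (s b)) →
    ∀ b X, toFun t (L.lact g b) (mfderiv 𝓘(ℝ, EB) 𝓘(ℝ, EB) (L.lact g) b X) =
      M.sharpAct c g b (toFun s b X)
  fibre : ∀ s b (X : FibreTangent L b), toFun s b X.1 = D₀.toFun s b X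

end PsiModule

end Main

end DGerbe

end

noncomputable section

namespace DGerbe

open Filter Topology Module

set_option linter.unusedSectionVars false

/-! ### Global sections of smooth vector bundles, and tensoriality -/

section BundleLemmas

variable {E : Type*} [NormedAddCommGroup E] [NormedSpace ℝ E]
  {M : Type*} [TopologicalSpace M] [ChartedSpace E M]

/-! Uniqueness of translations. Two module d-connections obey the same Leibniz rule, so the `df`
terms cancel in their difference, which is therefore a one-form on `B` with values in endomorphisms
of `W` (`tensorial_eq_zero`, `ModuleDConnection.exists_sub_eq`). Adaptedness puts its values in
`EndN`, it kills vectors tangent to the fibres because both connections equal `D₀` there, and it is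
equivariant. So it is basic: it descends to a form on `V` (`exists_translate_eq`), unique because
`dπ` is surjective and every vector of `W` is the value of a section (`translate_injective`).
Conversely a pulled-back form is tensorial, adapted, equivariant and zero along the fibres, so
adding it preserves every axiom (`ModuleDConnection.translate`).

Existence is the substantial point. As `D₀` prescribes the vertical part, it is enough to find an
equivariant horizontal lift of the tangent vectors of `V` and an equivariant derivative `conn` along
it; then `D = conn ∘ dπ + D₀ ∘ (id - lift ∘ dπ)`. Locally, let `σ` be a section of `B → V`, fix a
trivialization of `W` near its image, choose `g` with `g · b = σ (π b)`, and differentiate along `y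
↦ g⁻¹ · σ y`. Cutting down to the two summands makes this adapted. The element `g` is unique up to
the isotropy `ℤ_k × ℤ_k`, which acts by a constant on each summand, so the result does not depend on
`g` (`sliceLift_congr`, `sliceConn_congr`), and this independence yields equivariance. The
conditions survive convex combinations with weights pulled back from `V`, so a partition of unity on
`V` glues the local pairs (`nonempty_horizontalConnection`).

For the N-splitting, `θ = (θ - θ ∘ N) + θ ∘ N` is linear algebra at each point; only smoothness of
`θ ∘ N` needs an argument, and it uses the horizontal lift once more (`comp_mem_adForms`). -/

theorem exists_bump [FiniteDimensional ℝ E] [IsManifold 𝓘(ℝ, E) ∞ M] [T2Space M] {x : M}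
    {u : Set M} (hu : u ∈ 𝓝 x) :
    ∃ χ : M → ℝ, ContMDiff 𝓘(ℝ, E) 𝓘(ℝ, ℝ) ∞ χ ∧ tsupport χ ⊆ u ∧ χ =ᶠ[𝓝 x] 1 := by
  obtain ⟨f, -, hf⟩ := (SmoothBumpFunction.nhds_basis_tsupport (I := 𝓘(ℝ, E)) x).mem_iff.1 hu
  exact ⟨f, f.contMDiff, hf, f.eventuallyEq_one⟩

theorem exists_contMDiff_eventuallyEq [FiniteDimensional ℝ E] [IsManifold 𝓘(ℝ, E) ∞ M] [T2Space M]
    {x : M} {u : Set M} (hu : IsOpen u) (hx : x ∈ u) {f : M → ℝ}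
    (hf : ContMDiffOn 𝓘(ℝ, E) 𝓘(ℝ, ℝ) ∞ f u) :
    ∃ g : C^∞⟮𝓘(ℝ, E), M; 𝓘(ℝ, ℝ), ℝ⟯, ∀ᶠ y in 𝓝 x, g y = f y := by
  obtain ⟨χ, hχ, hs, h1⟩ := exists_bump (E := E) (hu.mem_nhds hx)
  refine ⟨⟨fun y => χ y • f y, contMDiff_of_tsupport fun y hy => ?_⟩, ?_⟩
  · have hy' : y ∈ u := hs (tsupport_smul_subset_left χ f hy)
    exact hχ.contMDiffAt.smul (hf.contMDiffAt (hu.mem_nhds hy'))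
  · filter_upwards [h1] with y hy
    simp [hy]

variable {F : Type*} [NormedAddCommGroup F] [NormedSpace ℝ F]
  {W : M → Type*} [∀ x, AddCommGroup (W x)] [∀ x, Module ℝ (W x)] [∀ x, TopologicalSpace (W x)]
  [TopologicalSpace (TotalSpace F W)] [FiberBundle F W] [VectorBundle ℝ F W]

theorem exists_section_eventuallyEq [FiniteDimensional ℝ E] [IsManifold 𝓘(ℝ, E) ∞ M] [T2Space M]
    {x : M} {u : Set M} (hu : IsOpen u) (hx : x ∈ u) {s : ∀ y, W y}
    (hs : ContMDiffOn 𝓘(ℝ, E) (𝓘(ℝ, E).prod 𝓘(ℝ, F)) ∞ (fun y => TotalSpace.mk' F y (s y)) u) :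
    ∃ t : Cₛ^∞⟮𝓘(ℝ, E); F, W⟯, ∀ᶠ y in 𝓝 x, t y = s y := by
  obtain ⟨χ, hχ, hsupp, h1⟩ := exists_bump (E := E) (hu.mem_nhds hx)
  refine ⟨⟨χ • s, ContMDiffOn.smul_section_of_tsupport hχ.contMDiffOn hu hsupp hs⟩, ?_⟩
  filter_upwards [h1] with y hy
  change χ y • s y = s y
  simp [hy]

theorem exists_section_frame [FiniteDimensional ℝ E] [IsManifold 𝓘(ℝ, E) ∞ M] [T2Space M]
    [ContMDiffVectorBundle ∞ F W 𝓘(ℝ, E)] {ι : Type*} (b : Basis ι ℝ F) (x : M) (i : ι) :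
    ∃ t : Cₛ^∞⟮𝓘(ℝ, E); F, W⟯,
      ∀ᶠ y in 𝓝 x, t y = (trivializationAt F W x).localFrame b i y :=
  exists_section_eventuallyEq (trivializationAt F W x).open_baseSet
    (mem_baseSet_trivializationAt F W x)
    ((trivializationAt F W x).contMDiffOn_localFrame_baseSet ∞ b i)

theorem exists_section_apply_eq [FiniteDimensional ℝ E] [IsManifold 𝓘(ℝ, E) ∞ M] [T2Space M]
    [ContMDiffVectorBundle ∞ F W 𝓘(ℝ, E)] (x : M) (w : W x) :
    ∃ t : Cₛ^∞⟮𝓘(ℝ, E); F, W⟯, t x = w := by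
  obtain ⟨s, hs, hsw⟩ := FiberBundle.exists_contMDiffOn_extend (k := ∞) 𝓘(ℝ, E) F w
  obtain ⟨u, hus, hu, hxu⟩ := mem_nhds_iff.1 hs
  obtain ⟨t, ht⟩ := exists_section_eventuallyEq hu hxu (hsw.mono hus)
  exact ⟨t, by simpa using ht.self_of_nhds⟩

/-- A fibrewise linear map which sends smooth sections to smooth sections sends smooth maps into the
total space to smooth maps. -/
theorem contMDiffAt_fibrewise [FiniteDimensional ℝ E] [IsManifold 𝓘(ℝ, E) ∞ M] [T2Space M]
    [FiniteDimensional ℝ F] [ContMDiffVectorBundle ∞ F W 𝓘(ℝ, E)]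
    {F' : Type*} [NormedAddCommGroup F'] [NormedSpace ℝ F']
    {W' : M → Type*} [∀ x, AddCommGroup (W' x)] [∀ x, Module ℝ (W' x)]
    [∀ x, TopologicalSpace (W' x)]
    [TopologicalSpace (TotalSpace F' W')] [FiberBundle F' W'] [VectorBundle ℝ F' W']
    [ContMDiffVectorBundle ∞ F' W' 𝓘(ℝ, E)]
    (φ : ∀ x, W x →ₗ[ℝ] W' x)
    (hφ : ∀ s : Cₛ^∞⟮𝓘(ℝ, E); F, W⟯, ContMDiff 𝓘(ℝ, E) (𝓘(ℝ, E).prod 𝓘(ℝ, F')) ∞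
      (fun x => TotalSpace.mk' F' x (φ x (s x))))
    {EN HN : Type*} [NormedAddCommGroup EN] [NormedSpace ℝ EN] [TopologicalSpace HN]
    {IN : ModelWithCorners ℝ EN HN}
    {N : Type*} [TopologicalSpace N] [ChartedSpace HN N] {f : N → M} {w : ∀ y, W (f y)} {y₀ : N}
    (hw : ContMDiffAt IN (𝓘(ℝ, E).prod 𝓘(ℝ, F)) ∞ (fun y => TotalSpace.mk' F (f y) (w y)) y₀) :
    ContMDiffAt IN (𝓘(ℝ, E).prod 𝓘(ℝ, F')) ∞
      (fun y => TotalSpace.mk' F' (f y) (φ (f y) (w y))) y₀ := by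
  have hx : f y₀ ∈ (trivializationAt F W (f y₀)).baseSet := mem_baseSet_trivializationAt F W (f y₀)
  have hx' : f y₀ ∈ (trivializationAt F' W' (f y₀)).baseSet :=
    mem_baseSet_trivializationAt F' W' (f y₀)
  obtain ⟨hf, hw2⟩ := ((trivializationAt F W (f y₀)).contMDiffAt_iff
    ((trivializationAt F W (f y₀)).mem_source.2 hx)).1 hw
  refine ((trivializationAt F' W' (f y₀)).contMDiffAt_iff
    ((trivializationAt F' W' (f y₀)).mem_source.2 hx')).2 ⟨hf, ?_⟩
  let b := Module.finBasis ℝ F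
  choose t ht using exists_section_frame (E := E) (W := W) b (f y₀)
  have hφt : ∀ i, ContMDiffAt IN 𝓘(ℝ, F') ∞
      (fun y => (trivializationAt F' W' (f y₀) ⟨f y, φ (f y) (t i (f y))⟩).2) y₀ := fun i =>
    (((trivializationAt F' W' (f y₀)).contMDiffAt_section_iff hx').1 (hφ (t i) (f y₀))).comp y₀ hf
  have hc : ∀ i, ContMDiffAt IN 𝓘(ℝ, ℝ) ∞
      (fun y => b.repr (trivializationAt F W (f y₀) ⟨f y, w y⟩).2 i) y₀ := fun i =>
    ((b.coord i).toContinuousLinearMap.contMDiff.contMDiffAt).comp y₀ hw2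
  have hsum : ContMDiffAt IN 𝓘(ℝ, F') ∞ (fun y => ∑ i,
      b.repr (trivializationAt F W (f y₀) ⟨f y, w y⟩).2 i •
        (trivializationAt F' W' (f y₀) ⟨f y, φ (f y) (t i (f y))⟩).2) y₀ :=
    contMDiffAt_finsetSum fun i _ => (hc i).smul (hφt i)
  refine hsum.congr_of_eventuallyEq ?_
  have hcont : Tendsto f (𝓝 y₀) (𝓝 (f y₀)) := hf.continuousAt
  filter_upwards [hcont.eventually ((trivializationAt F W (f y₀)).open_baseSet.mem_nhds hx),
    hcont.eventually ((trivializationAt F' W' (f y₀)).open_baseSet.mem_nhds hx'),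
    hcont.eventually (eventually_all.2 ht)] with y hy hy' hty
  -- The vector is a combination of global sections `t i` with smooth coefficients, so knowing `φ`
  -- on global sections is enough.
  have hwy : w y = ∑ i, b.repr (trivializationAt F W (f y₀) ⟨f y, w y⟩).2 i • t i (f y) := by
    have h1 := ((trivializationAt F W (f y₀)).basisAt b hy).sum_repr (w y)
    conv_lhs => rw [← h1]
    refine Finset.sum_congr rfl fun i _ => ?_
    rw [hty i, Trivialization.localFrame_apply_of_mem_baseSet _ b hy]
    congr 1
  have hlin := ((trivializationAt F' W' (f y₀)).linear ℝ hy')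
  conv_lhs => rw [hwy]
  have := map_sum ((hlin.mk' _).comp (φ (f y)))
    (fun i => b.repr (trivializationAt F W (f y₀) ⟨f y, w y⟩).2 i • t i (f y)) Finset.univ
  simp only [map_smul] at this
  exact this

/-- An additive operation on smooth sections which is linear over smooth functions at `x` depends
only on the value of the section at `x`. -/
theorem tensorial_eq_zero [FiniteDimensional ℝ E] [IsManifold 𝓘(ℝ, E) ∞ M] [T2Space M]
    [FiniteDimensional ℝ F] [ContMDiffVectorBundle ∞ F W 𝓘(ℝ, E)]
    {A : Type*} [AddCommGroup A] [Module ℝ A] (x : M) (Φ : Cₛ^∞⟮𝓘(ℝ, E); F, W⟯ → A)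
    (hadd : ∀ s t, Φ (s + t) = Φ s + Φ t)
    (hsmul : ∀ (f : C^∞⟮𝓘(ℝ, E), M; 𝓘(ℝ, ℝ), ℝ⟯) (s t : Cₛ^∞⟮𝓘(ℝ, E); F, W⟯),
      (∀ y, t y = f y • s y) → Φ t = f x • Φ s)
    (s : Cₛ^∞⟮𝓘(ℝ, E); F, W⟯) (hs : s x = 0) : Φ s = 0 := by
  have hloc : ∀ s t : Cₛ^∞⟮𝓘(ℝ, E); F, W⟯, (∀ᶠ y in 𝓝 x, s y = t y) → Φ s = Φ t := by
    intro s t hst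
    obtain ⟨χ, hχ, hsupp, h1⟩ := exists_bump (E := E) hst
    -- Locality: `χ` is supported where `s` and `t` agree, so `χ • s = χ • t` everywhere, while `χ x
    -- = 1`.
    let r : Cₛ^∞⟮𝓘(ℝ, E); F, W⟯ := ⟨χ • ⇑s, hχ.smul_section s.contMDiff⟩
    have hs : Φ r = χ x • Φ s := hsmul ⟨χ, hχ⟩ s r fun y => rfl
    have ht : Φ r = χ x • Φ t := hsmul ⟨χ, hχ⟩ t r fun y => by
      by_cases hy : y ∈ tsupport χ
      · change χ y • s y = χ y • t y
        have : s y = t y := hsupp hy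
        rw [this]
      · change χ y • s y = χ y • t y
        simp [image_eq_zero_of_notMem_tsupport hy]
    have h1x : χ x = 1 := h1.self_of_nhds
    rw [h1x, one_smul] at hs ht
    rw [← hs, ht]
  have hzero : Φ 0 = 0 := by
    have := hadd 0 0
    simpa using this
  let e := trivializationAt F W x
  have hx : x ∈ e.baseSet := mem_baseSet_trivializationAt F W x
  let b := Module.finBasis ℝ F
  choose t ht using exists_section_frame (E := E) (W := W) b x
  -- The frame coefficients of `s`, made global by a cut-off. They vanish at `x` because `s x = 0`,
  -- so `Φ` kills each term of the expansion.
  have hc : ∀ i, ∃ g : C^∞⟮𝓘(ℝ, E), M; 𝓘(ℝ, ℝ), ℝ⟯,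
      ∀ᶠ y in 𝓝 x, g y = b.repr (e ⟨y, s y⟩).2 i := fun i => by
    refine exists_contMDiff_eventuallyEq e.open_baseSet hx fun y hy => ?_
    have h1 := (e.contMDiffAt_section_iff hy).1 (s.contMDiff y)
    exact (((b.coord i).toContinuousLinearMap.contMDiff.contMDiffAt).comp y h1).contMDiffWithinAt
  choose g hg using hc
  let r : Fin (finrank ℝ F) → Cₛ^∞⟮𝓘(ℝ, E); F, W⟯ := fun i =>
    ⟨⇑(g i) • ⇑(t i), (g i).contMDiff.smul_section (t i).contMDiff⟩
  have hsumΦ : ∀ S : Finset (Fin (finrank ℝ F)), Φ (∑ i ∈ S, r i) = ∑ i ∈ S, Φ (r i) := by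
    intro S
    induction S using Finset.induction_on with
    | empty => simpa using hzero
    | insert a S ha ih => rw [Finset.sum_insert ha, Finset.sum_insert ha, hadd, ih]
  have hr : ∀ i, Φ (r i) = 0 := fun i => by
    have h0 : g i x = 0 := by
      rw [(hg i).self_of_nhds, hs]
      have : (e ⟨x, (0 : W x)⟩).2 = 0 := (e.linear ℝ hx).map_zero
      simp [this]
    rw [hsmul (g i) (t i) (r i) fun y => rfl, h0, zero_smul]
  rw [hloc s (∑ i, r i), hsumΦ, Finset.sum_eq_zero fun i _ => hr i]
  filter_upwards [e.open_baseSet.mem_nhds hx, eventually_all.2 ht, eventually_all.2 hg]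
    with y hy hty hgy
  have hcoe : (∑ i, r i) y = ∑ i, r i y := by
    have := map_sum (ContMDiffSection.coeAddHom 𝓘(ℝ, E) F ∞ W) r Finset.univ
    exact (congrFun this y).trans (Finset.sum_apply _ _ _)
  rw [hcoe]
  have h1 := (e.basisAt b hy).sum_repr (s y)
  rw [← h1]
  refine Finset.sum_congr rfl fun i _ => ?_
  change _ = g i y • t i y
  rw [hty i, hgy i, Trivialization.localFrame_apply_of_mem_baseSet _ b hy]
  congr 1

theorem contMDiffAt_trivialization_symm [ContMDiffVectorBundle ∞ F W 𝓘(ℝ, E)]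
    (e : Trivialization F (TotalSpace.proj : TotalSpace F W → M)) [MemTrivializationAtlas e]
    {EN HN : Type*} [NormedAddCommGroup EN] [NormedSpace ℝ EN] [TopologicalSpace HN]
    {IN : ModelWithCorners ℝ EN HN}
    {N : Type*} [TopologicalSpace N] [ChartedSpace HN N] {f : N → M} {v : N → F} {y₀ : N}
    (hf : ContMDiffAt IN 𝓘(ℝ, E) ∞ f y₀) (hv : ContMDiffAt IN 𝓘(ℝ, F) ∞ v y₀)
    (hy₀ : f y₀ ∈ e.baseSet) :
    ContMDiffAt IN (𝓘(ℝ, E).prod 𝓘(ℝ, F)) ∞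
      (fun y => TotalSpace.mk' F (f y) (e.symm (f y) (v y))) y₀ := by
  refine (e.contMDiffAt_iff (e.mem_source.2 hy₀)).2 ⟨hf, hv.congr_of_eventuallyEq ?_⟩
  filter_upwards [hf.continuousAt (e.open_baseSet.mem_nhds hy₀)] with y hy
  rw [e.apply_mk_symm hy]

end BundleLemmas

/-! ### Derivatives of families of maps depending smoothly on a parameter -/

section Tangent

/-- The derivative of a smooth family of maps, applied to a smooth family of vectors, is smooth. -/
theorem contMDiffAt_mfderiv_apply
    {EN HN : Type*} [NormedAddCommGroup EN] [NormedSpace ℝ EN] [TopologicalSpace HN]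
    {IN : ModelWithCorners ℝ EN HN}
    {N : Type*} [TopologicalSpace N] [ChartedSpace HN N] [IsManifold IN ∞ N]
    {E H : Type*} [NormedAddCommGroup E] [NormedSpace ℝ E] [TopologicalSpace H]
    {I : ModelWithCorners ℝ E H}
    {M : Type*} [TopologicalSpace M] [ChartedSpace H M] [IsManifold I ∞ M]
    {E' H' : Type*} [NormedAddCommGroup E'] [NormedSpace ℝ E'] [TopologicalSpace H']
    {I' : ModelWithCorners ℝ E' H'}
    {M' : Type*} [TopologicalSpace M'] [ChartedSpace H' M'] [IsManifold I' ∞ M']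
    {f : N → M → M'} {g : N → M} {w : ∀ y, TangentSpace I (g y)} {y₀ : N}
    (hf : ContMDiffAt (IN.prod I) I' ∞ (Function.uncurry f) (y₀, g y₀))
    (hw : ContMDiffAt IN (I.prod 𝓘(ℝ, E)) ∞ (fun y => TotalSpace.mk' E (g y) (w y)) y₀) :
    ContMDiffAt IN (I'.prod 𝓘(ℝ, E')) ∞
      (fun y => TotalSpace.mk' E' (E := (TangentSpace I' : M' → Type _)) (f y (g y))
        (mfderiv I I' (f y) (g y) (w y))) y₀ := by
  have hg : ContMDiffAt IN I ∞ g y₀ := (contMDiffAt_totalSpace.1 hw).1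
  have h := ContMDiffAt.mfderiv (m := ∞) (n := ∞) f g hf hg (by simp)
  have hb : ContMDiffAt IN I' ∞ (fun y => f y (g y)) y₀ :=
    ContMDiffAt.comp y₀ (g := Function.uncurry f) (f := fun y => (y, g y)) hf
      (contMDiffAt_id.prodMk hg)
  exact ContMDiffAt.clm_apply_of_inCoordinates (F₁ := E) (F₂ := E')
    (E₁ := (TangentSpace I : M → Type _)) (E₂ := (TangentSpace I' : M' → Type _)) h hw hb

end Tangent

section Main

variable {k n m : ℕ} {V : Type*} [TopologicalSpace V]
  [ChartedSpace (EuclideanSpace ℝ (Fin (n + m))) V]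
  {EB : Type*} [NormedAddCommGroup EB] [NormedSpace ℝ EB]
  {B : Type*} [TopologicalSpace B] [ChartedSpace EB B]
  {Eh : Type*} [NormedAddCommGroup Eh] [NormedSpace ℝ Eh]
  {Ev : Type*} [NormedAddCommGroup Ev] [NormedSpace ℝ Ev]
  {Gh Gv Gch Gcv : Type*}
  [Group Gh] [TopologicalSpace Gh] [ChartedSpace Eh Gh]
  [Group Gv] [TopologicalSpace Gv] [ChartedSpace Ev Gv]
  [Group Gch] [TopologicalSpace Gch] [ChartedSpace Eh Gch]
  [Group Gcv] [TopologicalSpace Gcv] [ChartedSpace Ev Gcv]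

/-! ### The principal bundle `B → V`: group action, local slices, differential of the projection -/

namespace LiftingGerbe

variable (L : LiftingGerbe k n m V EB B Eh Ev Gh Gv Gch Gcv)

theorem contMDiff_cov :
    ContMDiff (𝓘(ℝ, Eh).prod 𝓘(ℝ, Ev)) (𝓘(ℝ, Eh).prod 𝓘(ℝ, Ev)) ∞ L.cov :=
  L.extH.localDiffeo.contMDiff.prodMap L.extV.localDiffeo.contMDiff

theorem lact_inv_lact (g : Gch × Gcv) (b : B) : L.lact g⁻¹ (L.lact g b) = b := by
  rw [← lact_mul, inv_mul_cancel, lact_one]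

theorem lact_lact_inv (g : Gch × Gcv) (b : B) : L.lact g (L.lact g⁻¹ b) = b := by
  rw [← lact_mul, mul_inv_cancel, lact_one]

theorem proj_comp_lact (g : Gch × Gcv) : L.proj ∘ L.lact g = L.proj :=
  funext (L.proj_lact g)

/-- Local inverses of the two coverings. They turn the group coordinate of a trivialization of `B`,
which lies in `G`, into a smooth map to the extended group acting on `W`. -/
theorem exists_contMDiffAt_lift (a : Gh × Gv) :
    ∃ γ : Gh × Gv → Gch × Gcv,
      ContMDiffAt (𝓘(ℝ, Eh).prod 𝓘(ℝ, Ev)) (𝓘(ℝ, Eh).prod 𝓘(ℝ, Ev)) ∞ γ a ∧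
      ∀ᶠ a' in 𝓝 a, L.cov (γ a') = a' := by
  obtain ⟨a₁, a₂⟩ := a
  obtain ⟨g₁, rfl⟩ := L.extH.proj_surjective a₁
  obtain ⟨g₂, rfl⟩ := L.extV.proj_surjective a₂
  have h₁ := L.extH.localDiffeo g₁
  have h₂ := L.extV.localDiffeo g₂
  refine ⟨Prod.map h₁.localInverse h₂.localInverse,
    h₁.localInverse_contMDiffAt.prodMap h₂.localInverse_contMDiffAt, ?_⟩
  rw [nhds_prod_eq]
  filter_upwards [h₁.localInverse_eventuallyEq_right.prod_mk h₂.localInverse_eventuallyEq_right]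
    with a' h
  exact Prod.ext h.1 h.2

section Smooth

variable [LieGroup 𝓘(ℝ, Eh) ∞ Gh] [LieGroup 𝓘(ℝ, Ev) ∞ Gv]

theorem contMDiff_lact :
    ContMDiff ((𝓘(ℝ, Eh).prod 𝓘(ℝ, Ev)).prod 𝓘(ℝ, EB)) 𝓘(ℝ, EB) ∞
      (fun p : (Gch × Gcv) × B => L.lact p.1 p.2) := by
  have h : ContMDiff ((𝓘(ℝ, Eh).prod 𝓘(ℝ, Ev)).prod 𝓘(ℝ, EB)) (𝓘(ℝ, Eh).prod 𝓘(ℝ, Ev)) ∞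
      (fun p : (Gch × Gcv) × B => (L.cov p.1)⁻¹) :=
    (L.contMDiff_cov.comp contMDiff_fst).inv
  exact L.rightAct_smooth.comp (contMDiff_snd.prodMk h)

theorem contMDiff_lact_const (g : Gch × Gcv) : ContMDiff 𝓘(ℝ, EB) 𝓘(ℝ, EB) ∞ (L.lact g) :=
  L.contMDiff_lact.comp (contMDiff_const.prodMk contMDiff_id)

/-- Chain rule for `π ∘ g = π`. The two sides live over base points that are only propositionally
equal, hence the comparison in the model space. -/
theorem mfderiv_proj_lact (g : Gch × Gcv) (b : B) (X : TangentSpace 𝓘(ℝ, EB) b) :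
    mfderiv 𝓘(ℝ, EB) (𝓡 (n + m)) L.proj (L.lact g b)
      (mfderiv 𝓘(ℝ, EB) 𝓘(ℝ, EB) (L.lact g) b X) =
      (mfderiv 𝓘(ℝ, EB) (𝓡 (n + m)) L.proj b X : EuclideanSpace ℝ (Fin (n + m))) := by
  have h := mfderiv_comp b (L.proj_smooth.mdifferentiable (by simp) (L.lact g b))
    ((L.contMDiff_lact_const g).mdifferentiable (by simp) b)
  rw [L.proj_comp_lact g] at h
  exact (DFunLike.congr_fun h X).symm

end Smooth

/-- Local smooth sections of `B → V`, together with local smooth maps into the extended d-group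
moving the points of `B` onto them. -/
theorem exists_local_slice (x : V) :
    ∃ (U : Set V) (σ : V → B), IsOpen U ∧ x ∈ U ∧
      ContMDiffOn (𝓡 (n + m)) 𝓘(ℝ, EB) ∞ σ U ∧ (∀ y ∈ U, L.proj (σ y) = y) ∧
      ∀ b, L.proj b ∈ U → ∃ γ : B → Gch × Gcv,
        ContMDiffAt 𝓘(ℝ, EB) (𝓘(ℝ, Eh).prod 𝓘(ℝ, Ev)) ∞ γ b ∧
        ∀ᶠ b' in 𝓝 b, L.lact (γ b') b' = σ (L.proj b') := by
  obtain ⟨e, hx, he, hes, H⟩ := L.localTriv x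
  refine ⟨e.baseSet, fun y => e.toOpenPartialHomeomorph.symm (y, 1), e.open_baseSet, hx, ?_, ?_, ?_⟩
  · exact hes.comp (contMDiffOn_id.prodMk contMDiffOn_const)
      fun y hy => e.mem_target.2 hy
  · exact fun y hy => e.proj_symm_apply' hy
  · intro b hb
    obtain ⟨γ, hγ, hγc⟩ := L.exists_contMDiffAt_lift (e b).2
    have he2 : ContMDiffAt 𝓘(ℝ, EB) (𝓘(ℝ, Eh).prod 𝓘(ℝ, Ev)) ∞ (fun b' => (e b').2) b :=
      contMDiffAt_snd.comp b (he.contMDiffAt (e.open_source.mem_nhds (e.mem_source.2 hb)))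
    refine ⟨fun b' => γ (e b').2, hγ.comp b he2, ?_⟩
    filter_upwards [e.open_source.mem_nhds (e.mem_source.2 hb), he2.continuousAt.eventually hγc]
      with b' hb' hc
    -- In the trivialization the action multiplies the group coordinate `a` by the inverse of `cov
    -- (γ a) = a`, so it lands on the unit slice.
    obtain ⟨H1, H2⟩ := H b' (e.mem_source.1 hb') (L.cov (γ (e b').2))⁻¹
    have h3 : e (L.lact (γ (e b').2) b') = (L.proj b', 1) := by
      refine H2.trans (Prod.ext (e.coe_fst hb') ?_)
      simp only
      rw [hc, mul_inv_cancel]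
    rw [← h3]
    refine (e.toOpenPartialHomeomorph.left_inv (e.mem_source.2 ?_)).symm
    rw [proj_lact]
    exact e.mem_source.1 hb'

/-- The slice, translated so as to pass through `b`, is a local right inverse of the projection. -/
theorem mfderiv_proj_surjective [IsManifold (𝓡 (n + m)) ∞ V] [LieGroup 𝓘(ℝ, Eh) ∞ Gh]
    [LieGroup 𝓘(ℝ, Ev) ∞ Gv] (b : B) :
    Function.Surjective (mfderiv 𝓘(ℝ, EB) (𝓡 (n + m)) L.proj b) := by
  obtain ⟨U, σ, hU, hbU, hσ, hσp, hγ⟩ := L.exists_local_slice (L.proj b)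
  obtain ⟨γ, -, hγb⟩ := hγ b hbU
  have hb : L.lact (γ b)⁻¹ (σ (L.proj b)) = b := by
    rw [← hγb.self_of_nhds, lact_inv_lact]
  have hτ : ContMDiffAt (𝓡 (n + m)) 𝓘(ℝ, EB) ∞ (fun y => L.lact (γ b)⁻¹ (σ y)) (L.proj b) :=
    ((L.contMDiff_lact_const (γ b)⁻¹).contMDiffAt).comp _ (hσ.contMDiffAt (hU.mem_nhds hbU))
  have hd := hτ.mdifferentiableAt (by simp)
  have hcomp : (L.proj ∘ fun y => L.lact (γ b)⁻¹ (σ y)) =ᶠ[𝓝 (L.proj b)] id := by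
    filter_upwards [hU.mem_nhds hbU] with y hy
    simp [proj_lact, hσp y hy]
  have h := mfderiv_comp (L.proj b)
    (L.proj_smooth.mdifferentiable (by simp) (L.lact (γ b)⁻¹ (σ (L.proj b)))) hd
  rw [hcomp.mfderiv_eq, mfderiv_id] at h
  rw [hb] at h
  exact fun Y => ⟨_, (DFunLike.congr_fun h Y).symm⟩

end LiftingGerbe

variable {F : Type*} [NormedAddCommGroup F] [NormedSpace ℂ F]
  {W : B → Type*} [∀ b, AddCommGroup (W b)] [∀ b, Module ℂ (W b)] [∀ b, TopologicalSpace (W b)]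
  [TopologicalSpace (TotalSpace F W)] [FiberBundle F W]

/-! ### The action of the extended group on sections of `W` -/

namespace PsiModule

variable [NeZero k] {L : LiftingGerbe k n m V EB B Eh Ev Gh Gv Gch Gcv} {q : ℤ}
  (M : PsiModule F W L q)

theorem act_inv_act (g : Gch × Gcv) (b : B) (w : W b) :
    TotalSpace.mk' F (L.lact g⁻¹ (L.lact g b)) (M.act g⁻¹ (L.lact g b) (M.act g b w)) =
      TotalSpace.mk' F b w := by
  have h := M.act_mul g⁻¹ g b w
  rw [inv_mul_cancel, M.act_one] at h
  exact h.symm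

/-- Trades inverting the action of `g` for acting by `g⁻¹`, to which `act_smooth` applies. -/
theorem mk_act_symm (g : Gch × Gcv) (b : B) (w : W (L.lact g b)) :
    TotalSpace.mk' F b ((M.act g b).symm w) =
      TotalSpace.mk' F (L.lact g⁻¹ (L.lact g b)) (M.act g⁻¹ (L.lact g b) w) := by
  obtain ⟨w, rfl⟩ := (M.act g b).surjective w
  rw [LinearEquiv.symm_apply_apply, M.act_inv_act]

/-- The scalar endomorphisms through which `U(1) × U(1)` acts on `W`. -/
def scale (c : Circle × Circle) (b : B) : W b →ₗ[ℂ] W b :=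
  ((c.1 ^ q : Circle) : ℂ) • M.hProj b + ((c.2 ^ q : Circle) : ℂ) • (LinearMap.id - M.hProj b)

theorem sharpAct_eq (c : Circle × Circle) (g : Gch × Gcv) (b : B) (w : W b) :
    M.sharpAct c g b w = M.act g b (M.scale c b w) := by
  simp [sharpAct, scale]

@[simp]
theorem sharpAct_one (g : Gch × Gcv) (b : B) (w : W b) : M.sharpAct 1 g b w = M.act g b w := by
  simp [sharpAct]

/-- The component in `hW` of a smooth section. -/
def hSec (s : Cₛ^∞⟮𝓘(ℝ, EB); F, W⟯) : Cₛ^∞⟮𝓘(ℝ, EB); F, W⟯ :=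
  ⟨fun b => M.hProj b (s b), M.hProj_smooth s s.contMDiff⟩

@[simp]
theorem hSec_apply (s : Cₛ^∞⟮𝓘(ℝ, EB); F, W⟯) (b : B) : M.hSec s b = M.hProj b (s b) := rfl

/-- Equivariance of a connection is stated for pairs `s`, `t` with `t` a translate of `s`; this
supplies the `t`, so that the condition can be used for every `s`. -/
theorem exists_translate [LieGroup 𝓘(ℝ, Eh) ∞ Gh] [LieGroup 𝓘(ℝ, Ev) ∞ Gv]
    (g : Gch × Gcv) (s : Cₛ^∞⟮𝓘(ℝ, EB); F, W⟯) :
    ∃ t : Cₛ^∞⟮𝓘(ℝ, EB); F, W⟯, ∀ b, t (L.lact g b) = M.act g b (s b) := by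
  refine ⟨⟨fun b => (M.act g⁻¹ b).symm (s (L.lact g⁻¹ b)), ?_⟩, fun b => ?_⟩
  · have h : ContMDiff 𝓘(ℝ, EB) (𝓘(ℝ, EB).prod 𝓘(ℝ, F)) ∞ (fun b : B =>
        TotalSpace.mk' F (L.lact g⁻¹⁻¹ (L.lact g⁻¹ b))
          (M.act g⁻¹⁻¹ (L.lact g⁻¹ b) (s (L.lact g⁻¹ b)))) :=
      M.act_smooth.comp (f := fun b : B => ((g⁻¹⁻¹ : Gch × Gcv),
        TotalSpace.mk' F (L.lact g⁻¹ b) (s (L.lact g⁻¹ b))))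
        (contMDiff_const.prodMk (s.contMDiff.comp (L.contMDiff_lact_const g⁻¹)))
    exact h.congr fun b => M.mk_act_symm g⁻¹ b _
  · change (M.act g⁻¹ (L.lact g b)).symm (s (L.lact g⁻¹ (L.lact g b))) = _
    rw [LinearEquiv.symm_apply_eq]
    have h1 := M.act_inv_act g b (s b)
    have h2 : TotalSpace.mk' F (L.lact g⁻¹ (L.lact g b)) (s (L.lact g⁻¹ (L.lact g b))) =
        TotalSpace.mk' F b (s b) := by rw [L.lact_inv_lact]
    exact TotalSpace.mk_inj.1 (h2.trans h1.symm)

/-! ### The affine structure: differences of module d-connections are forms on `V` -/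

section Torsor

section Pullback

variable (θ : ∀ x : V, TangentSpace (𝓡 (n + m)) x →ₗ[ℝ] M.AdFiber x)

theorem pullback_eq {x : V} (b : B) (hb : L.proj b = x) (X : TangentSpace 𝓘(ℝ, EB) b) :
    M.pullback θ b X = (M.adIso b hb).symm
      (θ x (mfderiv 𝓘(ℝ, EB) (𝓡 (n + m)) L.proj b X : EuclideanSpace ℝ (Fin (n + m)))) := by
  subst hb
  rfl

theorem pullback_add (b : B) (X Y : TangentSpace 𝓘(ℝ, EB) b) :
    M.pullback θ b (X + Y) = M.pullback θ b X + M.pullback θ b Y := by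
  simp [pullback]

theorem pullback_smul (b : B) (c : ℝ) (X : TangentSpace 𝓘(ℝ, EB) b) :
    M.pullback θ b (c • X) = c • M.pullback θ b X := by
  have h := ((M.adIso b rfl).symm.restrictScalars ℝ).map_smul c
    (θ (L.proj b) (mfderiv 𝓘(ℝ, EB) (𝓡 (n + m)) L.proj b X))
  simp only [pullback, map_smul]
  exact h

/-- The pull-back of a one-form on `V` with values in `𝓔(W)`, applied to a vector of `W`. -/
def pullbackApply (b : B) (w : W b) : TangentSpace 𝓘(ℝ, EB) b →ₗ[ℝ] W b where
  toFun X := (M.pullback θ b X).1 w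
  map_add' X Y := by simp [pullback_add]
  map_smul' c X := by simp [pullback_smul]

theorem pullbackApply_apply (b : B) (w : W b) (X : TangentSpace 𝓘(ℝ, EB) b) :
    M.pullbackApply θ b w X = (M.pullback θ b X).1 w := rfl

theorem conj_adIso_symm {x : V} (b : B) (hb : L.proj b = x) (g : Gch × Gcv) (a : M.AdFiber x) :
    M.conj g b ((M.adIso b hb).symm a) =
      (M.adIso (L.lact g b) ((L.proj_lact g b).trans hb)).symm a := by
  rw [LinearEquiv.eq_symm_apply]
  obtain ⟨A, rfl⟩ := (M.adIso b hb).surjective a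
  rw [LinearEquiv.symm_apply_apply]
  exact M.adMk_conj b hb g A

/-- The group changes neither `dπ X` nor the class in `𝓔(W)`; it only changes the representing
endomorphism, by conjugation. -/
theorem pullback_lact [IsManifold 𝓘(ℝ, EB) ∞ B] [LieGroup 𝓘(ℝ, Eh) ∞ Gh]
    [LieGroup 𝓘(ℝ, Ev) ∞ Gv] (g : Gch × Gcv) (b : B) (X : TangentSpace 𝓘(ℝ, EB) b) :
    M.pullback θ (L.lact g b) (mfderiv 𝓘(ℝ, EB) 𝓘(ℝ, EB) (L.lact g) b X) =
      M.conj g b (M.pullback θ b X) := by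
  rw [M.pullback_eq θ (L.lact g b) (L.proj_lact g b), L.mfderiv_proj_lact, pullback,
    M.conj_adIso_symm]

end Pullback

/-- Why equivariance under the `U(1)` factors costs nothing: they act by scalars on each summand,
and N-adapted endomorphisms preserve the summands. -/
theorem scale_commute (c : Circle × Circle) (b : B) (A : M.EndN b) (w : W b) :
    A.1 (M.scale c b w) = M.scale c b (A.1 w) := by
  simp [scale, A.2 w]

variable [IsManifold 𝓘(ℝ, EB) ∞ B] [VectorBundle ℂ F W] [VectorBundle ℝ F W]
  [ContMDiffVectorBundle ∞ F W 𝓘(ℝ, EB)]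

@[ext]
theorem ModuleDConnection.ext {M : PsiModule F W L q} {D₀ : M.FibreDConnection}
    {D D' : M.ModuleDConnection D₀} (h : ∀ s b X, D.toFun s b X = D'.toFun s b X) : D = D' := by
  obtain ⟨⟨f, _, _, _, _⟩, _, _⟩ := D
  obtain ⟨⟨f', _, _, _, _⟩, _, _⟩ := D'
  obtain rfl : f = f' := by
    funext s b
    exact LinearMap.ext (h s b)
  rfl

variable {M} {D₀ : M.FibreDConnection}

/-- The translate of a module d-connection by a one-form with values in `𝓔(W)`. -/
def ModuleDConnection.translate [LieGroup 𝓘(ℝ, Eh) ∞ Gh]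
    [LieGroup 𝓘(ℝ, Ev) ∞ Gv] (θ : M.AdForms) (D : M.ModuleDConnection D₀) :
    M.ModuleDConnection D₀ where
  toFun s b := D.toFun s b + M.pullbackApply θ.1 b (s b)
  smooth s X := ContMDiff.add_section (D.smooth s X) (θ.2 X s)
  add s t b X := by
    simp only [LinearMap.add_apply, pullbackApply_apply, D.add, ContMDiffSection.coe_add, Pi.add_apply,
      map_add]
    abel
  leibniz f s t h b X := by
    simp only [LinearMap.add_apply, pullbackApply_apply, D.leibniz f s t h b X, h b,
      map_smul, smul_add]
    abel
  adapted s t h b X := by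
    simp only [LinearMap.add_apply, pullbackApply_apply, D.adapted s t h b X, h b,
      map_add, (M.pullback θ.1 b X).2 (s b)]
  equivariant c g s t h b X := by
    simp only [LinearMap.add_apply, pullbackApply_apply,
      D.equivariant c g s t h b X, h b, M.pullback_lact, M.sharpAct_eq, conj_act, scale_commute,
      map_add]
  fibre s b X := by
    have hX : mfderiv 𝓘(ℝ, EB) (𝓡 (n + m)) L.proj b X.1 = 0 := X.2
    simp [D.fibre s b X, pullback, pullbackApply_apply, hX]

namespace ModuleDConnection

variable (D D' : M.ModuleDConnection D₀)

/-- The `df` terms of the two Leibniz rules cancel, so the difference is tensorial. Real functions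
enter the complex Leibniz rule through `ℝ → ℂ`. -/
theorem sub_eq_zero_of_apply_eq_zero [FiniteDimensional ℝ EB] [FiniteDimensional ℂ F] [T2Space B]
    (s : Cₛ^∞⟮𝓘(ℝ, EB); F, W⟯) (b : B) (hs : s b = 0) (X : TangentSpace 𝓘(ℝ, EB) b) :
    D.toFun s b X - D'.toFun s b X = 0 := by
  have : FiniteDimensional ℝ F := FiniteDimensional.complexToReal F
  refine tensorial_eq_zero b (fun s => D.toFun s b X - D'.toFun s b X) (fun s t => ?_)
    (fun f s t h => ?_) s hs
  · simp only [D.add, D'.add]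
    abel
  · have hf : ContMDiff 𝓘(ℝ, EB) 𝓘(ℝ, ℂ) ∞ (fun b => (f b : ℂ)) :=
      Complex.ofRealCLM.contMDiff.comp f.contMDiff
    let f' : C^∞⟮𝓘(ℝ, EB), B; 𝓘(ℝ, ℂ), ℂ⟯ := ⟨_, hf⟩
    have h' : ∀ b, t b = f' b • s b := fun b => h b
    simp only [D.leibniz f' s t h' b X, D'.leibniz f' s t h' b X, add_sub_add_left_eq_sub,
      ← smul_sub]
    rfl

/-- The endomorphism is found by evaluating the difference on any section through a given vector; by
tensoriality the choice of section is immaterial. -/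
theorem exists_sub_eq [FiniteDimensional ℝ EB] [FiniteDimensional ℂ F] [T2Space B] (b : B) :
    ∃ A : TangentSpace 𝓘(ℝ, EB) b →ₗ[ℝ] M.EndN b,
      ∀ s X, D.toFun s b X = D'.toFun s b X + (A X).1 (s b) := by
  choose ext hext using exists_section_apply_eq (E := EB) (F := F) (W := W) b
  have key : ∀ (s : Cₛ^∞⟮𝓘(ℝ, EB); F, W⟯) (w : W b), s b = w → ∀ X,
      D.toFun s b X - D'.toFun s b X = D.toFun (ext w) b X - D'.toFun (ext w) b X := by
    intro s w hs X
    have h := sub_eq_zero_of_apply_eq_zero D D' (s - ext w) b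
      (by change s b - ext w b = 0; rw [hext, hs, sub_self]) X
    have e1 := D.add (s - ext w) (ext w) b X
    have e2 := D'.add (s - ext w) (ext w) b X
    rw [sub_add_cancel] at e1 e2
    rw [e1, e2, add_sub_add_comm, h, zero_add]
  let A : TangentSpace 𝓘(ℝ, EB) b → (W b →ₗ[ℂ] W b) := fun X =>
    { toFun := fun w => D.toFun (ext w) b X - D'.toFun (ext w) b X
      map_add' := fun w w' => by
        rw [← key (ext w + ext w') (w + w') (by change ext w b + ext w' b = _; rw [hext, hext]) X,
          D.add, D'.add]
        abel
      map_smul' := fun c w => by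
        have hc : ContMDiff 𝓘(ℝ, EB) (𝓘(ℝ, EB).prod 𝓘(ℝ, F)) ∞
          (fun b => TotalSpace.mk' F b (c • ext w b)) := smoothSec_smul c (ext w).contMDiff
        -- Complex homogeneity is the Leibniz rule for a constant function.
        let f : C^∞⟮𝓘(ℝ, EB), B; 𝓘(ℝ, ℂ), ℂ⟯ := ⟨fun _ => c, contMDiff_const⟩
        rw [← key ⟨_, hc⟩ (c • w) (by change c • ext w b = _; rw [hext]) X,
          D.leibniz f (ext w) ⟨_, hc⟩ (fun _ => rfl), D'.leibniz f (ext w) ⟨_, hc⟩ (fun _ => rfl),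
          add_sub_add_left_eq_sub, ← smul_sub]
        rfl }
  have hA : ∀ X, A X ∈ M.EndN b := fun X w => by
    change D.toFun (ext _) b X - D'.toFun (ext _) b X = _
    rw [← key (M.hSec (ext w)) (M.hProj b w) (by rw [hSec_apply, hext]) X,
      D.adapted (ext w) _ (fun _ => rfl), D'.adapted (ext w) _ (fun _ => rfl), ← map_sub]
    rfl
  refine ⟨{ toFun := fun X => ⟨A X, hA X⟩, map_add' := fun X Y => ?_, map_smul' := fun c X => ?_ },
    fun s X => ?_⟩
  · ext w
    change D.toFun (ext w) b (X + Y) - D'.toFun (ext w) b (X + Y) =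
      (D.toFun (ext w) b X - D'.toFun (ext w) b X) + (D.toFun (ext w) b Y - D'.toFun (ext w) b Y)
    rw [map_add, map_add]
    abel
  · ext w
    change D.toFun (ext w) b (c • X) - D'.toFun (ext w) b (c • X) =
      c • (D.toFun (ext w) b X - D'.toFun (ext w) b X)
    rw [map_smul, map_smul, smul_sub]
  · exact eq_add_of_sub_eq' (key s (s b) rfl X)

variable [FiniteDimensional ℝ EB] [FiniteDimensional ℂ F] [T2Space B]
  [IsManifold (𝓡 (n + m)) ∞ V] [LieGroup 𝓘(ℝ, Eh) ∞ Gh] [LieGroup 𝓘(ℝ, Ev) ∞ Gv]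

theorem exists_translate_eq : ∃ θ : M.AdForms, translate θ D' = D := by
  choose A hA using exists_sub_eq D D'
  -- Along the fibres both connections are `D₀`.
  have hker : ∀ b (X : TangentSpace 𝓘(ℝ, EB) b),
      mfderiv 𝓘(ℝ, EB) (𝓡 (n + m)) L.proj b X = 0 → A b X = 0 := fun b X hX => by
    ext w
    obtain ⟨s, rfl⟩ := exists_section_apply_eq (E := EB) (F := F) (W := W) b w
    have h := hA b s X
    rw [D.fibre s b ⟨X, hX⟩, D'.fibre s b ⟨X, hX⟩] at h
    simpa using h
  have hequiv : ∀ g b (X : TangentSpace 𝓘(ℝ, EB) b),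
      A (L.lact g b) (mfderiv 𝓘(ℝ, EB) 𝓘(ℝ, EB) (L.lact g) b X) = M.conj g b (A b X) := by
    intro g b X
    ext w
    obtain ⟨w, rfl⟩ := (M.act g b).surjective w
    obtain ⟨s, rfl⟩ := exists_section_apply_eq (E := EB) (F := F) (W := W) b w
    obtain ⟨t, ht⟩ := M.exists_translate g s
    have h := hA (L.lact g b) t (mfderiv 𝓘(ℝ, EB) 𝓘(ℝ, EB) (L.lact g) b X)
    have ht' : ∀ b, t (L.lact g b) = M.sharpAct 1 g b (s b) := fun b => by rw [ht, sharpAct_one]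
    rw [D.equivariant 1 g s t ht', D'.equivariant 1 g s t ht', sharpAct_one, sharpAct_one, ht,
      hA b s X, map_add] at h
    rw [conj_act]
    exact (add_left_cancel h).symm
  -- Only a pointwise linear right inverse of `dπ` is needed: smoothness of the resulting form is
  -- checked on its pull-back.
  have hR : ∀ b : B, ∃ R : EuclideanSpace ℝ (Fin (n + m)) →ₗ[ℝ] TangentSpace 𝓘(ℝ, EB) b,
      ∀ Y, mfderiv 𝓘(ℝ, EB) (𝓡 (n + m)) L.proj b (R Y) = Y := fun b => by
    obtain ⟨R, hR⟩ := (mfderiv 𝓘(ℝ, EB) (𝓡 (n + m)) L.proj b).toLinearMap.exists_rightInverse_of_surjective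
      (LinearMap.range_eq_top.2 (L.mfderiv_proj_surjective b))
    exact ⟨R, fun Y => DFunLike.congr_fun hR Y⟩
  choose R hR using hR
  -- Defined through an arbitrary point over `x` and an arbitrary lift of the tangent vector; `hθ`
  -- shows that neither choice matters.
  let θ : ∀ x : V, TangentSpace (𝓡 (n + m)) x →ₗ[ℝ] M.AdFiber x := fun x =>
    ((M.adIso _ (L.exists_point x).choose_spec).toLinearMap.restrictScalars ℝ) ∘ₗ
      (A (L.exists_point x).choose ∘ₗ R (L.exists_point x).choose)
  have hθ : ∀ b X, M.pullback θ b X = A b X := by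
    intro b X
    have hb := (L.exists_point (L.proj b)).choose_spec
    have hθb : ∀ Y, θ (L.proj b) Y = M.adIso _ hb (A _ (R _ Y)) := fun Y => rfl
    rw [pullback, hθb]
    generalize (L.exists_point (L.proj b)).choose = b₁ at hb
    obtain ⟨g, hg⟩ := L.exists_lact hb
    subst hg
    have h1 := M.conj_adIso_symm b₁ hb g
      (M.adIso b₁ hb (A b₁ (R b₁ (mfderiv 𝓘(ℝ, EB) (𝓡 (n + m)) L.proj (L.lact g b₁) X))))
    rw [LinearEquiv.symm_apply_apply] at h1
    refine h1.symm.trans ?_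
    -- The moved lift and `X` have the same image under `dπ`, so they differ by a vector tangent to
    -- the fibre, which `hker` kills.
    rw [← hequiv, ← sub_eq_zero, ← map_sub]
    refine hker _ _ ?_
    rw [map_sub, L.mfderiv_proj_lact]
    exact sub_eq_zero.2 (hR _ _)
  -- The pull-back of `θ` is the difference of the two connections, which is smooth on smooth
  -- sections and fields.
  have hmem : θ ∈ M.AdForms := fun X s => by
    have h := (D.smooth s X).sub_section (D'.smooth s X)
    refine h.congr fun b => ?_
    refine congrArg (TotalSpace.mk' F b) ?_
    change (M.pullback θ b (X b)).1 (s b) = D.toFun s b (X b) - D'.toFun s b (X b)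
    rw [hθ, hA, add_sub_cancel_left]
  refine ⟨⟨θ, hmem⟩, ModuleDConnection.ext fun s b X => ?_⟩
  change D'.toFun s b X + (M.pullback θ b X).1 (s b) = _
  rw [hθ, hA]

theorem translate_injective {θ θ' : M.AdForms} (h : translate θ D = translate θ' D) : θ = θ' := by
  refine Subtype.ext (funext fun x => LinearMap.ext fun Y => ?_)
  obtain ⟨b, rfl⟩ := L.exists_point x
  obtain ⟨X, rfl⟩ := L.mfderiv_proj_surjective b Y
  refine (M.adIso b rfl).symm.injective ?_
  ext w
  obtain ⟨s, rfl⟩ := exists_section_apply_eq (E := EB) (F := F) (W := W) b w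
  have h1 : D.toFun s b X + (M.pullback θ.1 b X).1 (s b) =
      D.toFun s b X + (M.pullback θ'.1 b X).1 (s b) :=
    congrArg (fun D : M.ModuleDConnection D₀ => D.toFun s b X) h
  exact add_left_cancel h1

/-- Module d-connections form an affine space over the one-forms with values in `𝓔(W)`, as soon as
there is one of them. -/
@[reducible]
def addTorsor [Nonempty (M.ModuleDConnection D₀)] :
    AddTorsor M.AdForms (M.ModuleDConnection D₀) where
  vadd := translate
  zero_vadd D := ModuleDConnection.ext fun s b X => by
    change D.toFun s b X + (M.pullback 0 b X).1 (s b) = _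
    simp [pullback]
  add_vadd θ θ' D := ModuleDConnection.ext fun s b X => by
    change D.toFun s b X + (M.pullback (θ.1 + θ'.1) b X).1 (s b) =
      (D.toFun s b X + (M.pullback θ'.1 b X).1 (s b)) + (M.pullback θ.1 b X).1 (s b)
    simp [pullback]
    abel
  vsub D D' := (exists_translate_eq D D').choose
  vsub_vadd' D D' := (exists_translate_eq D D').choose_spec
  vadd_vsub' θ D := translate_injective D (exists_translate_eq (translate θ D) D).choose_spec

end ModuleDConnection

end Torsor

/-! ### Differentiating vector-valued functions on `V` -/

/-- The derivative of a vector valued function on `V`. -/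
def vderiv {A : Type*} [NormedAddCommGroup A] [NormedSpace ℝ A] (u : V → A) (x : V) :
    EuclideanSpace ℝ (Fin (n + m)) →L[ℝ] A :=
  mfderiv (𝓡 (n + m)) 𝓘(ℝ, A) u x

theorem vderiv_add {A : Type*} [NormedAddCommGroup A] [NormedSpace ℝ A] {u v : V → A} {x : V}
    (hu : MDifferentiableAt (𝓡 (n + m)) 𝓘(ℝ, A) u x)
    (hv : MDifferentiableAt (𝓡 (n + m)) 𝓘(ℝ, A) v x) :
    vderiv (n := n) (m := m) (u + v) x = vderiv u x + vderiv v x :=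
  mfderiv_add hu hv

theorem vderiv_smul {x : V} {f : V → ℂ} {u : V → F}
    (hf : MDifferentiableAt (𝓡 (n + m)) 𝓘(ℝ, ℂ) f x)
    (hu : MDifferentiableAt (𝓡 (n + m)) 𝓘(ℝ, F) u x) (Y : EuclideanSpace ℝ (Fin (n + m))) :
    vderiv (fun y => f y • u y) x Y = vderiv f x Y • u x + f x • vderiv u x Y := by
  have h1 := hf.hasMFDerivAt
  have h2 := hu.hasMFDerivAt
  have h : HasMFDerivAt (𝓡 (n + m)) 𝓘(ℝ, F) (fun y => f y • u y) x
      (f x • vderiv (n := n) (m := m) u x + (vderiv (n := n) (m := m) f x).smulRight (u x)) :=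
    ⟨h1.1.smul h2.1, by
      have h3 := h1.2.smul h2.2
      simp only [writtenInExtChartAt, mfld_simps] at h3 ⊢
      exact h3⟩
  rw [vderiv, h.mfderiv]
  exact add_comm _ _

theorem vderiv_const_smul {x : V} {u : V → F} (c : ℂ)
    (hu : MDifferentiableAt (𝓡 (n + m)) 𝓘(ℝ, F) u x) (Y : EuclideanSpace ℝ (Fin (n + m))) :
    vderiv (fun y => c • u y) x Y = c • vderiv u x Y := by
  have h : vderiv (n := n) (m := m) (fun _ : V => c) x Y = 0 := by
    rw [vderiv, mfderiv_const]
    rfl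
  rw [vderiv_smul mdifferentiableAt_const hu, h, zero_smul, zero_add]

/-! ### Translates of sections and the scalar action of the isotropy group -/

theorem mk_lact_eq (s : ∀ b, W b) {b b' : B} (h : b = b') :
    TotalSpace.mk' F b (s b) = TotalSpace.mk' F b' (s b') := by
  rw [h]

theorem _root_.DGerbe.LiftingGerbe.cov_ker (L : LiftingGerbe k n m V EB B Eh Ev Gh Gv Gch Gcv)
    (z z' : ZMod k) : L.cov (L.ker z z') = 1 :=
  Prod.ext ((L.extH.exact _).2 ⟨_, rfl⟩) ((L.extV.exact _).2 ⟨_, rfl⟩)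

theorem _root_.DGerbe.LiftingGerbe.lact_ker (L : LiftingGerbe k n m V EB B Eh Ev Gh Gv Gch Gcv)
    (z z' : ZMod k) (b : B) : L.lact (L.ker z z') b = b := by
  simp [LiftingGerbe.lact, L.cov_ker, L.rightAct_one]

theorem _root_.DGerbe.LiftingGerbe.exists_eq_mul_ker
    (L : LiftingGerbe k n m V EB B Eh Ev Gh Gv Gch Gcv) {g g' : Gch × Gcv} {b : B}
    (h : L.lact g b = L.lact g' b) : ∃ z z', g' = g * L.ker z z' := by
  obtain ⟨z, z', hz⟩ := L.lact_eq_self (g := g⁻¹ * g') (b := b)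
    (by rw [L.lact_mul, ← h, L.lact_inv_lact])
  exact ⟨z, z', by rw [← hz, mul_inv_cancel_left]⟩

/-- The left translate of a section of `W`. -/
def transl (g : Gch × Gcv) (s : ∀ b, W b) (b : B) : W b := (M.act g⁻¹ b).symm (s (L.lact g⁻¹ b))

theorem mk_transl (g : Gch × Gcv) (s : ∀ b, W b) (b : B) :
    TotalSpace.mk' F b (M.transl g s b) = TotalSpace.mk' F (L.lact g (L.lact g⁻¹ b))
      (M.act g (L.lact g⁻¹ b) (s (L.lact g⁻¹ b))) := by
  have h := M.mk_act_symm g⁻¹ b (s (L.lact g⁻¹ b))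
  rwa [inv_inv] at h

theorem transl_lact (g : Gch × Gcv) (s : ∀ b, W b) (b : B) :
    M.transl g s (L.lact g b) = M.act g b (s b) := by
  rw [transl, LinearEquiv.symm_apply_eq]
  exact TotalSpace.mk_inj.1 ((mk_lact_eq (F := F) s (L.lact_inv_lact g b)).trans
    (M.act_inv_act g b (s b)).symm)

/-- Every point has the form `g · b`, so a translate is determined by its values there. The calculus
of `transl` below rests on this. -/
theorem eq_transl {g : Gch × Gcv} {s t : ∀ b, W b} (h : ∀ b, t (L.lact g b) = M.act g b (s b)) :
    t = M.transl g s := by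
  funext b
  obtain ⟨b, rfl⟩ : ∃ b', L.lact g b' = b := ⟨_, L.lact_lact_inv g b⟩
  rw [h, transl_lact]

theorem transl_mul (g h : Gch × Gcv) (s : ∀ b, W b) :
    M.transl (g * h) s = M.transl g (M.transl h s) := by
  refine (M.eq_transl fun b => ?_).symm
  refine TotalSpace.mk_inj.1 (((mk_lact_eq (F := F) _ (L.lact_mul g h b)).trans ?_).trans
    (M.act_mul g h b (s b)).symm)
  rw [transl_lact, transl_lact]

theorem transl_hProj (g : Gch × Gcv) (s : ∀ b, W b) :
    M.transl g (fun b => M.hProj b (s b)) = fun b => M.hProj b (M.transl g s b) :=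
  (M.eq_transl fun b => by rw [transl_lact, hProj_act]).symm

theorem transl_sub (g : Gch × Gcv) (s t : ∀ b, W b) :
    M.transl g (s - t) = M.transl g s - M.transl g t :=
  (M.eq_transl fun b => by simp [transl_lact]).symm

theorem transl_add (g : Gch × Gcv) (s t : ∀ b, W b) :
    M.transl g (s + t) = M.transl g s + M.transl g t :=
  (M.eq_transl fun b => by simp [transl_lact]).symm

theorem transl_smul (g : Gch × Gcv) (c : ℂ) (s : ∀ b, W b) :
    M.transl g (c • s) = c • M.transl g s :=
  (M.eq_transl fun b => by simp [transl_lact]).symm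

theorem scale_ker_eq (z z' : ZMod k) (b : B) (w : W b) :
    TotalSpace.mk' F (L.lact (L.ker z z') b) (M.act (L.ker z z') b w) =
      TotalSpace.mk' F b (M.scale (ZMod.toCircle z, ZMod.toCircle z') b w) := by
  rw [M.act_ker]
  rfl

theorem transl_ker (z z' : ZMod k) (s : ∀ b, W b) :
    M.transl (L.ker z z') s = fun b => M.scale (ZMod.toCircle z, ZMod.toCircle z') b (s b) := by
  refine (M.eq_transl fun b => (TotalSpace.mk_inj (F := F)).1 ?_).symm
  rw [M.scale_ker_eq]
  exact mk_lact_eq (F := F)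
    (fun b => M.scale (ZMod.toCircle z, ZMod.toCircle z') b (s b)) (L.lact_ker z z' b)

theorem hProj_scale (c : Circle × Circle) (b : B) (w : W b) :
    M.hProj b (M.scale c b w) = ((c.1 ^ q : Circle) : ℂ) • M.hProj b w := by
  simp [scale, M.hProj_idem]

/-- Each summand is multiplied by a number of modulus one. This lets a factor coming from the
isotropy be cancelled in `sliceConn_congr`. -/
theorem scale_injective (c : Circle × Circle) (b : B) : Function.Injective (M.scale c b) := by
  rw [injective_iff_map_eq_zero]
  intro w hw
  have h1 : M.hProj b w = 0 := by
    have h := M.hProj_scale c b w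
    rw [hw, map_zero] at h
    exact (smul_eq_zero.1 h.symm).resolve_left (Circle.coe_ne_zero _)
  simp only [scale, LinearMap.add_apply, LinearMap.smul_apply, LinearMap.sub_apply, h1,
    LinearMap.id_apply, smul_zero, sub_zero, zero_add] at hw
  exact (smul_eq_zero.1 hw).resolve_left (Circle.coe_ne_zero _)

theorem transl_fsmul (g : Gch × Gcv) (f : B → ℂ) (s : ∀ b, W b) :
    M.transl g (fun b => f b • s b) = fun b => f (L.lact g⁻¹ b) • M.transl g s b :=
  (M.eq_transl fun b => by rw [transl_lact, L.lact_inv_lact, map_smul]).symm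

/-! ### Horizontal derivatives along translates of a local slice -/

section Slice

/-- The derivative at `π(b)` of the translate by `g⁻¹` of a local section `σ` of `B → V`. -/
def sliceLift (L : LiftingGerbe k n m V EB B Eh Ev Gh Gv Gch Gcv) (σ : V → B) (g : Gch × Gcv)
    (b : B) : EuclideanSpace ℝ (Fin (n + m)) →L[ℝ] TangentSpace 𝓘(ℝ, EB) b :=
  mfderiv (𝓡 (n + m)) 𝓘(ℝ, EB) (fun y => L.lact g⁻¹ (σ y)) (L.proj b)

/-- The two group elements differ by the isotropy, which acts trivially on `B`, so they define the
same translated slice. -/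
theorem sliceLift_congr (σ : V → B) {g g' : Gch × Gcv} {b : B} (h : L.lact g b = L.lact g' b) :
    sliceLift L σ g b = sliceLift L σ g' b := by
  obtain ⟨z, z', rfl⟩ := L.exists_eq_mul_ker h
  have h1 : ∀ y, L.lact (g * L.ker z z')⁻¹ (σ y) = L.lact g⁻¹ (σ y) := fun y => by
    rw [mul_inv_rev, L.lact_mul]
    conv_lhs => rw [← L.lact_ker z z' (L.lact g⁻¹ (σ y))]
    rw [L.lact_inv_lact]
  -- The tangent space receiving the derivative depends on the map, so the congruence is taken in
  -- the model space `EB`.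
  exact congrArg (fun τ : V → B => show EuclideanSpace ℝ (Fin (n + m)) →L[ℝ] EB from
    mfderiv (𝓡 (n + m)) 𝓘(ℝ, EB) τ (L.proj b)) (funext h1).symm

variable [LieGroup 𝓘(ℝ, Eh) ∞ Gh] [LieGroup 𝓘(ℝ, Ev) ∞ Gv]

theorem contMDiffAt_lact_slice {σ : V → B} {x : V} (hσ : ContMDiffAt (𝓡 (n + m)) 𝓘(ℝ, EB) ∞ σ x)
    (g : Gch × Gcv) :
    ContMDiffAt (𝓡 (n + m)) 𝓘(ℝ, EB) ∞ (fun y => L.lact g⁻¹ (σ y)) x :=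
  ((L.contMDiff_lact_const g⁻¹).contMDiffAt).comp x hσ

theorem sliceLift_lact {σ : V → B} (g h : Gch × Gcv) {b : B}
    (hσ : ContMDiffAt (𝓡 (n + m)) 𝓘(ℝ, EB) ∞ σ (L.proj b))
    (hg : L.lact (g * h) b = σ (L.proj b)) (Y : EuclideanSpace ℝ (Fin (n + m))) :
    sliceLift L σ g (L.lact h b) Y =
      mfderiv 𝓘(ℝ, EB) 𝓘(ℝ, EB) (L.lact h) b (sliceLift L σ (g * h) b Y) := by
  have h1 : (fun y => L.lact g⁻¹ (σ y)) = L.lact h ∘ fun y => L.lact (g * h)⁻¹ (σ y) := by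
    funext y
    rw [Function.comp_apply, ← L.lact_mul]
    simp
  have h2 := mfderiv_comp (L.proj b)
    ((L.contMDiff_lact_const h).mdifferentiable (by simp) (L.lact (g * h)⁻¹ (σ (L.proj b))))
    ((contMDiffAt_lact_slice hσ (g * h)).mdifferentiableAt (by simp))
  rw [← h1] at h2
  rw [← hg, L.lact_inv_lact] at h2
  rw [sliceLift, L.proj_lact]
  exact DFunLike.congr_fun h2 Y

theorem mfderiv_proj_sliceLift [IsManifold (𝓡 (n + m)) ∞ V] {σ : V → B} {g : Gch × Gcv} {b : B}
    (hσ : ContMDiffAt (𝓡 (n + m)) 𝓘(ℝ, EB) ∞ σ (L.proj b))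
    (hσp : ∀ᶠ y in 𝓝 (L.proj b), L.proj (σ y) = y)
    (hg : L.lact g b = σ (L.proj b)) (Y : EuclideanSpace ℝ (Fin (n + m))) :
    mfderiv 𝓘(ℝ, EB) (𝓡 (n + m)) L.proj b (sliceLift L σ g b Y) = Y := by
  have hcomp : (L.proj ∘ fun y => L.lact g⁻¹ (σ y)) =ᶠ[𝓝 (L.proj b)] id := by
    filter_upwards [hσp] with y hy
    simp [L.proj_lact, hy]
  have h := mfderiv_comp (L.proj b)
    (L.proj_smooth.mdifferentiable (by simp) (L.lact g⁻¹ (σ (L.proj b))))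
    ((contMDiffAt_lact_slice hσ g).mdifferentiableAt (by simp))
  rw [hcomp.mfderiv_eq, mfderiv_id] at h
  rw [← hg, L.lact_inv_lact] at h
  exact (DFunLike.congr_fun h Y).symm

theorem cdiff_sliceLift {σ : V → B} {g : Gch × Gcv} {b : B}
    (hσ : ContMDiffAt (𝓡 (n + m)) 𝓘(ℝ, EB) ∞ σ (L.proj b))
    (hg : L.lact g b = σ (L.proj b)) {f : B → ℂ} (hf : ContMDiff 𝓘(ℝ, EB) 𝓘(ℝ, ℂ) ∞ f)
    (Y : EuclideanSpace ℝ (Fin (n + m))) :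
    vderiv (fun y => f (L.lact g⁻¹ (σ y))) (L.proj b) Y = cdiff f b (sliceLift L σ g b Y) := by
  have h := mfderiv_comp (L.proj b)
    (hf.mdifferentiable (by simp) (L.lact g⁻¹ (σ (L.proj b))))
    ((contMDiffAt_lact_slice hσ g).mdifferentiableAt (by simp))
  rw [← hg, L.lact_inv_lact] at h
  exact DFunLike.congr_fun h Y

variable [VectorBundle ℂ F W] (σ : V → B)
  (T : Trivialization F (TotalSpace.proj : TotalSpace F W → B)) [MemTrivializationAtlas T]

/-- The translate of a section of `W` by `g`, read in a trivialization of `W` along a local section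
`σ` of `B → V`. -/
def sliceCoord (g : Gch × Gcv) (s : ∀ b, W b) (y : V) : F :=
  T.linearMapAt ℂ (σ y) (M.transl g s (σ y))

/-- The derivative of a section of `W` in the directions of the translate by `g⁻¹` of a local
section `σ` of `B → V`, with respect to a trivialization of `W` along `σ`. -/
def sliceDeriv (g : Gch × Gcv) (s : ∀ b, W b) (b : B) :
    EuclideanSpace ℝ (Fin (n + m)) →ₗ[ℝ] W b :=
  (((M.act g b).symm.toLinearMap ∘ₗ T.symmₗ ℂ (L.lact g b)).restrictScalars ℝ) ∘ₗ
    (vderiv (M.sliceCoord σ T g s) (L.proj b)).toLinearMap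

theorem sliceDeriv_apply (g : Gch × Gcv) (s : ∀ b, W b) (b : B)
    (Y : EuclideanSpace ℝ (Fin (n + m))) :
    M.sliceDeriv σ T g s b Y = (M.act g b).symm (T.symmₗ ℂ (L.lact g b)
      (vderiv (M.sliceCoord σ T g s) (L.proj b) Y)) := rfl

/-- Translating by `h` and then by `g` is translating by `g * h`, so both sides differentiate the
same `F`-valued function on `V`. -/
theorem sliceDeriv_transl (g h : Gch × Gcv) (s : ∀ b, W b) (b : B)
    (Y : EuclideanSpace ℝ (Fin (n + m))) :
    M.sliceDeriv σ T g (M.transl h s) (L.lact h b) Y =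
      M.act h b (M.sliceDeriv σ T (g * h) s b Y) := by
  have h1 : M.sliceCoord σ T g (M.transl h s) = M.sliceCoord σ T (g * h) s := by
    funext y
    rw [sliceCoord, sliceCoord, transl_mul]
  simp only [sliceDeriv_apply, h1]
  rw [L.proj_lact, LinearEquiv.symm_apply_eq]
  have h2 := M.act_mul g h b ((M.act (g * h) b).symm (T.symmₗ ℂ (L.lact (g * h) b)
    (vderiv (M.sliceCoord σ T (g * h) s) (L.proj b) Y)))
  rw [LinearEquiv.apply_symm_apply] at h2
  exact (TotalSpace.mk_inj (F := F)).1 ((mk_lact_eq (F := F) (fun b' => T.symmₗ ℂ b'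
    (vderiv (M.sliceCoord σ T (g * h) s) (L.proj b) Y)) (L.lact_mul g h b)).symm.trans h2)

/-- The corresponding derivative preserving `W = hW ⊕ vW`. -/
def sliceConn (g : Gch × Gcv) (s : ∀ b, W b) (b : B) :
    EuclideanSpace ℝ (Fin (n + m)) →ₗ[ℝ] W b :=
  (M.hProj b).restrictScalars ℝ ∘ₗ M.sliceDeriv σ T g (fun b => M.hProj b (s b)) b +
    (LinearMap.id - M.hProj b).restrictScalars ℝ ∘ₗ
      M.sliceDeriv σ T g (s - fun b => M.hProj b (s b)) b

theorem sliceConn_apply (g : Gch × Gcv) (s : ∀ b, W b) (b : B)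
    (Y : EuclideanSpace ℝ (Fin (n + m))) :
    M.sliceConn σ T g s b Y =
      M.hProj b (M.sliceDeriv σ T g (fun b => M.hProj b (s b)) b Y) +
        (M.sliceDeriv σ T g (s - fun b => M.hProj b (s b)) b Y -
          M.hProj b (M.sliceDeriv σ T g (s - fun b => M.hProj b (s b)) b Y)) := rfl

theorem sliceConn_transl (g h : Gch × Gcv) (s : ∀ b, W b) (b : B)
    (Y : EuclideanSpace ℝ (Fin (n + m))) :
    M.sliceConn σ T g (M.transl h s) (L.lact h b) Y =
      M.act h b (M.sliceConn σ T (g * h) s b Y) := by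
  simp only [sliceConn_apply, ← transl_hProj, ← transl_sub, sliceDeriv_transl, hProj_act, map_add,
    map_sub]

variable [IsManifold 𝓘(ℝ, EB) ∞ B] [VectorBundle ℝ F W] [ContMDiffVectorBundle ∞ F W 𝓘(ℝ, EB)]
variable {σ T}

/-- Joint smoothness in both variables: in `contMDiffAt_sliceDeriv` the group element varies with
`b` while the derivative is taken in `y`. -/
theorem contMDiffAt_sliceCoord {x : V} (hσ : ContMDiffAt (𝓡 (n + m)) 𝓘(ℝ, EB) ∞ σ x)
    (hT : σ x ∈ T.baseSet) [LieGroup 𝓘(ℝ, Eh) ∞ Gch] [LieGroup 𝓘(ℝ, Ev) ∞ Gcv]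
    {γ : B → Gch × Gcv} {b : B} (hγ : ContMDiffAt 𝓘(ℝ, EB) (𝓘(ℝ, Eh).prod 𝓘(ℝ, Ev)) ∞ γ b)
    (s : Cₛ^∞⟮𝓘(ℝ, EB); F, W⟯) :
    ContMDiffAt (𝓘(ℝ, EB).prod (𝓡 (n + m))) 𝓘(ℝ, F) ∞
      (fun p : B × V => M.sliceCoord σ T (γ p.1) s p.2) (b, x) := by
  have hγ' : ContMDiffAt (𝓘(ℝ, EB).prod (𝓡 (n + m))) (𝓘(ℝ, Eh).prod 𝓘(ℝ, Ev)) ∞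
      (fun p : B × V => γ p.1) (b, x) := hγ.comp (b, x) contMDiffAt_fst
  have hσ' : ContMDiffAt (𝓘(ℝ, EB).prod (𝓡 (n + m))) 𝓘(ℝ, EB) ∞
      (fun p : B × V => σ p.2) (b, x) := ContMDiffAt.comp (b, x) (g := σ) hσ contMDiffAt_snd
  have h1 : ContMDiffAt (𝓘(ℝ, EB).prod (𝓡 (n + m))) 𝓘(ℝ, EB) ∞
      (fun p : B × V => L.lact (γ p.1)⁻¹ (σ p.2)) (b, x) :=
    L.contMDiff_lact.contMDiffAt.comp (b, x) (hγ'.inv.prodMk hσ')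
  have h2 : ContMDiffAt (𝓘(ℝ, EB).prod (𝓡 (n + m))) (𝓘(ℝ, EB).prod 𝓘(ℝ, F)) ∞
      (fun p : B × V => TotalSpace.mk' F (σ p.2) (M.transl (γ p.1) s (σ p.2))) (b, x) := by
    have h3 := M.act_smooth.contMDiffAt.comp (b, x)
      (hγ'.prodMk ((s.contMDiff.contMDiffAt).comp (b, x) h1))
    exact h3.congr_of_eventuallyEq (Eventually.of_forall fun p => M.mk_transl _ _ _)
  refine ((T.contMDiffAt_iff (T.mem_source.2 hT)).1 h2).2.congr_of_eventuallyEq ?_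
  filter_upwards [hσ'.continuousAt (T.open_baseSet.mem_nhds hT)] with p hp
  rw [sliceCoord, T.coe_linearMapAt_of_mem hp]

theorem sliceCoord_eq_add (g : Gch × Gcv) (s t : ∀ b, W b) :
    M.sliceCoord σ T g (s + t) = M.sliceCoord σ T g s + M.sliceCoord σ T g t := by
  funext y
  simp [sliceCoord, transl_add]

theorem sliceCoord_smul (g : Gch × Gcv) (c : ℂ) (s : ∀ b, W b) :
    M.sliceCoord σ T g (c • s) = fun y => c • M.sliceCoord σ T g s y := by
  funext y
  simp [sliceCoord, transl_smul]

theorem sliceCoord_fsmul (g : Gch × Gcv) (f : B → ℂ) (s : ∀ b, W b) :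
    M.sliceCoord σ T g (fun b => f b • s b) =
      fun y => f (L.lact g⁻¹ (σ y)) • M.sliceCoord σ T g s y := by
  funext y
  simp [sliceCoord, transl_fsmul]

theorem symm_sliceCoord (g : Gch × Gcv) (s : ∀ b, W b) {b : B} (hT : σ (L.proj b) ∈ T.baseSet)
    (hg : L.lact g b = σ (L.proj b)) :
    (M.act g b).symm (T.symmₗ ℂ (L.lact g b) (M.sliceCoord σ T g s (L.proj b))) = s b := by
  rw [← hg] at hT
  rw [sliceCoord, ← hg, T.symmₗ_linearMapAt hT, transl_lact, LinearEquiv.symm_apply_apply]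

section Pointwise

variable [LieGroup 𝓘(ℝ, Eh) ∞ Gch] [LieGroup 𝓘(ℝ, Ev) ∞ Gcv] {b : B}
  (hσ : ContMDiffAt (𝓡 (n + m)) 𝓘(ℝ, EB) ∞ σ (L.proj b)) (hT : σ (L.proj b) ∈ T.baseSet)
include hσ hT

theorem mdifferentiableAt_sliceCoord (g : Gch × Gcv) (s : Cₛ^∞⟮𝓘(ℝ, EB); F, W⟯) :
    MDifferentiableAt (𝓡 (n + m)) 𝓘(ℝ, F) (M.sliceCoord σ T g s) (L.proj b) :=
  (ContMDiffAt.comp (L.proj b) (M.contMDiffAt_sliceCoord hσ hT (γ := fun _ => g)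
    (contMDiffAt_const (x := b)) s)
    (contMDiffAt_const.prodMk contMDiffAt_id)).mdifferentiableAt (by simp)

theorem sliceDeriv_add (g : Gch × Gcv) (s t : Cₛ^∞⟮𝓘(ℝ, EB); F, W⟯)
    (Y : EuclideanSpace ℝ (Fin (n + m))) :
    M.sliceDeriv σ T g (⇑s + ⇑t) b Y = M.sliceDeriv σ T g s b Y + M.sliceDeriv σ T g t b Y := by
  simp only [sliceDeriv_apply]
  rw [sliceCoord_eq_add, vderiv_add (M.mdifferentiableAt_sliceCoord hσ hT g s)
    (M.mdifferentiableAt_sliceCoord hσ hT g t), add_apply, map_add, map_add]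

theorem sliceDeriv_smul (g : Gch × Gcv) (c : ℂ) (s : Cₛ^∞⟮𝓘(ℝ, EB); F, W⟯)
    (Y : EuclideanSpace ℝ (Fin (n + m))) :
    M.sliceDeriv σ T g (c • ⇑s) b Y = c • M.sliceDeriv σ T g s b Y := by
  simp only [sliceDeriv_apply]
  rw [sliceCoord_smul, vderiv_const_smul c (M.mdifferentiableAt_sliceCoord hσ hT g s), map_smul,
    map_smul]

theorem sliceDeriv_fsmul {g : Gch × Gcv} (hg : L.lact g b = σ (L.proj b)) {f : B → ℂ}
    (hf : ContMDiff 𝓘(ℝ, EB) 𝓘(ℝ, ℂ) ∞ f) (s : Cₛ^∞⟮𝓘(ℝ, EB); F, W⟯)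
    (Y : EuclideanSpace ℝ (Fin (n + m))) :
    M.sliceDeriv σ T g (fun b => f b • s b) b Y =
      cdiff f b (sliceLift L σ g b Y) • s b + f b • M.sliceDeriv σ T g s b Y := by
  simp only [sliceDeriv_apply]
  have hf' : MDifferentiableAt (𝓡 (n + m)) 𝓘(ℝ, ℂ) (fun y => f (L.lact g⁻¹ (σ y))) (L.proj b) :=
    (hf.contMDiffAt.comp (L.proj b) (contMDiffAt_lact_slice hσ g)).mdifferentiableAt (by simp)
  rw [sliceCoord_fsmul, vderiv_smul hf' (M.mdifferentiableAt_sliceCoord hσ hT g s),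
    cdiff_sliceLift hσ hg hf, map_add, map_smul, map_smul, map_add, map_smul, map_smul,
    M.symm_sliceCoord g s hT hg, ← hg, L.lact_inv_lact]

theorem sliceConn_add (g : Gch × Gcv) (s t : Cₛ^∞⟮𝓘(ℝ, EB); F, W⟯)
    (Y : EuclideanSpace ℝ (Fin (n + m))) :
    M.sliceConn σ T g (⇑s + ⇑t) b Y = M.sliceConn σ T g s b Y + M.sliceConn σ T g t b Y := by
  have h1 := M.sliceDeriv_add hσ hT g (M.hSec s) (M.hSec t) Y
  have h2 := M.sliceDeriv_add hσ hT g (s - M.hSec s) (t - M.hSec t) Y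
  have e1 : (fun b => M.hProj b ((⇑s + ⇑t) b)) = ⇑(M.hSec s) + ⇑(M.hSec t) := by
    funext b
    simp
  have e2 : (⇑s + ⇑t - fun b => M.hProj b ((⇑s + ⇑t) b)) =
      ⇑(s - M.hSec s) + ⇑(t - M.hSec t) := by
    rw [e1, ContMDiffSection.coe_sub, ContMDiffSection.coe_sub]
    abel
  rw [sliceConn_apply, e2, e1, h1, h2]
  simp only [sliceConn_apply, map_add]
  change _ = _ + (_ - _) + (_ + (_ - _))
  rw [ContMDiffSection.coe_sub, ContMDiffSection.coe_sub]
  change _ + (M.sliceDeriv σ T g (⇑s - ⇑(M.hSec s)) b Y + M.sliceDeriv σ T g (⇑t - ⇑(M.hSec t)) b Y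
    - _) = _
  simp only [show (fun b => M.hProj b (s b)) = ⇑(M.hSec s) from rfl,
    show (fun b => M.hProj b (t b)) = ⇑(M.hSec t) from rfl]
  abel

/-- Each term of `sliceConn` differentiates a section of one summand, on which the scaling is a
constant. For `sliceDeriv` alone this could fail, since the trivialization need not respect the
splitting. -/
theorem sliceConn_scale (c : Circle × Circle) (g : Gch × Gcv) (s : Cₛ^∞⟮𝓘(ℝ, EB); F, W⟯)
    (Y : EuclideanSpace ℝ (Fin (n + m))) :
    M.sliceConn σ T g (fun b => M.scale c b (s b)) b Y =
      M.scale c b (M.sliceConn σ T g s b Y) := by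
  have e1 : (fun b => M.hProj b (M.scale c b (s b))) =
      ((c.1 ^ q : Circle) : ℂ) • ⇑(M.hSec s) := by
    funext b
    rw [hProj_scale]
    rfl
  have e2 : ((fun b => M.scale c b (s b)) - fun b => M.hProj b (M.scale c b (s b))) =
      ((c.2 ^ q : Circle) : ℂ) • ⇑(s - M.hSec s) := by
    rw [e1]
    funext b
    simp [scale]
  rw [sliceConn_apply, e2, e1, M.sliceDeriv_smul hσ hT, M.sliceDeriv_smul hσ hT]
  simp only [sliceConn_apply, scale, map_smul, map_add, map_sub, LinearMap.add_apply,
    LinearMap.smul_apply, LinearMap.sub_apply, LinearMap.id_apply, M.hProj_idem]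
  rw [ContMDiffSection.coe_sub]
  simp only [show (fun b => M.hProj b (s b)) = ⇑(M.hSec s) from rfl]
  module

theorem sliceConn_fsmul {g : Gch × Gcv} (hg : L.lact g b = σ (L.proj b)) {f : B → ℂ}
    (hf : ContMDiff 𝓘(ℝ, EB) 𝓘(ℝ, ℂ) ∞ f) (s : Cₛ^∞⟮𝓘(ℝ, EB); F, W⟯)
    (Y : EuclideanSpace ℝ (Fin (n + m))) :
    M.sliceConn σ T g (fun b => f b • s b) b Y =
      cdiff f b (sliceLift L σ g b Y) • s b + f b • M.sliceConn σ T g s b Y := by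
  have e1 : (fun b => M.hProj b (f b • s b)) = fun b => f b • M.hSec s b := by
    funext b
    simp
  have e2 : ((fun b => f b • s b) - fun b => M.hProj b (f b • s b)) =
      fun b => f b • (s - M.hSec s) b := by
    rw [e1]
    funext b
    simp [smul_sub]
  have e3 : (s - M.hSec s) b = s b - M.hProj b (s b) := rfl
  rw [sliceConn_apply, e2, e1, M.sliceDeriv_fsmul hσ hT hg hf, M.sliceDeriv_fsmul hσ hT hg hf]
  simp only [sliceConn_apply, map_smul, map_add, e3, map_sub, hSec_apply, M.hProj_idem]
  rw [ContMDiffSection.coe_sub]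
  simp only [show (fun b => M.hProj b (s b)) = ⇑(M.hSec s) from rfl]
  module

theorem sliceConn_hProj (g : Gch × Gcv) (s : Cₛ^∞⟮𝓘(ℝ, EB); F, W⟯)
    (Y : EuclideanSpace ℝ (Fin (n + m))) :
    M.sliceConn σ T g (fun b => M.hProj b (s b)) b Y =
      M.hProj b (M.sliceConn σ T g s b Y) := by
  have h0 : M.sliceDeriv σ T g 0 b Y = 0 := by
    have h := M.sliceDeriv_smul hσ hT g 0 s Y
    simpa using h
  simp only [sliceConn_apply, sub_self, h0, map_zero, add_zero, map_add, map_sub, M.hProj_idem]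

/-- Changing `g` by the isotropy replaces the section by a scaled one; the scaling passes through
`sliceConn` and is undone by the action on the value. -/
theorem sliceConn_congr {g g' : Gch × Gcv} (h : L.lact g b = L.lact g' b)
    (s : Cₛ^∞⟮𝓘(ℝ, EB); F, W⟯) (Y : EuclideanSpace ℝ (Fin (n + m))) :
    M.sliceConn σ T g s b Y = M.sliceConn σ T g' s b Y := by
  obtain ⟨z, z', rfl⟩ := L.exists_eq_mul_ker h
  have h1 := M.sliceConn_transl σ T g (L.ker z z') s b Y
  rw [transl_ker] at h1
  refine M.scale_injective (ZMod.toCircle z, ZMod.toCircle z') b ?_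
  have h2 := M.scale_ker_eq z z' b (M.sliceConn σ T (g * L.ker z z') s b Y)
  rw [← h1] at h2
  rw [← M.sliceConn_scale hσ hT]
  exact (TotalSpace.mk_inj (F := F)).1
    ((mk_lact_eq (F := F) (fun b => M.sliceConn σ T g
      (fun b => M.scale (ZMod.toCircle z, ZMod.toCircle z') b (s b)) b Y)
      (L.lact_ker z z' b)).symm.trans h2)

end Pointwise

end Slice

/-! ### Smooth dependence of the slice derivatives on the point of `B` -/

section SliceSmooth

variable [LieGroup 𝓘(ℝ, Eh) ∞ Gh] [LieGroup 𝓘(ℝ, Ev) ∞ Gv] [LieGroup 𝓘(ℝ, Eh) ∞ Gch]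
  [LieGroup 𝓘(ℝ, Ev) ∞ Gcv] [IsManifold (𝓡 (n + m)) ∞ V] [IsManifold 𝓘(ℝ, EB) ∞ B]
  {σ : V → B} {b : B} (hσ : ContMDiffAt (𝓡 (n + m)) 𝓘(ℝ, EB) ∞ σ (L.proj b))
  {γ : B → Gch × Gcv} (hγ : ContMDiffAt 𝓘(ℝ, EB) (𝓘(ℝ, Eh).prod 𝓘(ℝ, Ev)) ∞ γ b)
  (hγσ : ∀ᶠ b' in 𝓝 b, L.lact (γ b') b' = σ (L.proj b'))
  {w : B → EuclideanSpace ℝ (Fin (n + m))}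
  (hw : ContMDiffAt 𝓘(ℝ, EB) ((𝓡 (n + m)).prod 𝓘(ℝ, EuclideanSpace ℝ (Fin (n + m)))) ∞
    (fun b => TotalSpace.mk' (EuclideanSpace ℝ (Fin (n + m)))
      (E := (TangentSpace (𝓡 (n + m)) : V → Type _)) (L.proj b) (w b)) b)
include hσ hγ hγσ hw

theorem contMDiffAt_sliceLift :
    ContMDiffAt 𝓘(ℝ, EB) (𝓘(ℝ, EB).prod 𝓘(ℝ, EB)) ∞
      (fun b => TotalSpace.mk' EB (E := (TangentSpace 𝓘(ℝ, EB) : B → Type _)) b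
        (sliceLift L σ (γ b) b (w b))) b := by
  have hf : ContMDiffAt (𝓘(ℝ, EB).prod (𝓡 (n + m))) 𝓘(ℝ, EB) ∞
      (Function.uncurry fun b y => L.lact (γ b)⁻¹ (σ y)) (b, L.proj b) :=
    L.contMDiff_lact.contMDiffAt.comp (b, L.proj b)
      ((ContMDiffAt.comp (b, L.proj b) (g := γ) hγ contMDiffAt_fst).inv.prodMk
        (ContMDiffAt.comp (b, L.proj b) (g := σ) hσ contMDiffAt_snd))
  refine (contMDiffAt_mfderiv_apply hf hw).congr_of_eventuallyEq ?_
  filter_upwards [hγσ] with b' hb'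
  -- The lifted vector is produced over `γ(b')⁻¹ · σ (π b')`, and that point is `b'`.
  have h : L.lact (γ b')⁻¹ (σ (L.proj b')) = b' := by rw [← hb', L.lact_inv_lact]
  exact congrArg (fun p => TotalSpace.mk' EB (E := (TangentSpace 𝓘(ℝ, EB) : B → Type _)) p
    (sliceLift L σ (γ b') b' (w b') : EB)) h.symm

variable [VectorBundle ℂ F W] [VectorBundle ℝ F W] [ContMDiffVectorBundle ∞ F W 𝓘(ℝ, EB)]
  {T : Trivialization F (TotalSpace.proj : TotalSpace F W → B)} [MemTrivializationAtlas T]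
  (hT : σ (L.proj b) ∈ T.baseSet)
include hT

theorem contMDiffAt_sliceDeriv (s : Cₛ^∞⟮𝓘(ℝ, EB); F, W⟯) :
    ContMDiffAt 𝓘(ℝ, EB) (𝓘(ℝ, EB).prod 𝓘(ℝ, F)) ∞
      (fun b => TotalSpace.mk' F b (M.sliceDeriv σ T (γ b) s b (w b))) b := by
  have h1 := contMDiffAt_mfderiv_apply (f := fun b y => M.sliceCoord σ T (γ b) s y)
    (g := L.proj) (M.contMDiffAt_sliceCoord hσ hT hγ s) hw
  have h2 : ContMDiffAt 𝓘(ℝ, EB) 𝓘(ℝ, F) ∞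
      (fun b => vderiv (M.sliceCoord σ T (γ b) s) (L.proj b) (w b)) b := by
    have h3 := (contMDiffAt_totalSpace.1 h1).2
    simp only [trivializationAt_model_space_apply] at h3
    exact h3
  have hσπ : ContMDiffAt 𝓘(ℝ, EB) 𝓘(ℝ, EB) ∞ (fun b => σ (L.proj b)) b :=
    hσ.comp b (L.proj_smooth b)
  have h3 := contMDiffAt_trivialization_symm T hσπ h2 hT
  have h4 := M.act_smooth.contMDiffAt.comp b (hγ.inv.prodMk h3)
  refine h4.congr_of_eventuallyEq ?_
  filter_upwards [hγσ, hσπ.continuousAt (T.open_baseSet.mem_nhds hT)] with b' hb' hTb'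
  rw [sliceDeriv_apply, mk_act_symm, hb', T.symmₗ_apply hTb']
  rfl

theorem contMDiffAt_sliceConn [FiniteDimensional ℝ EB] [FiniteDimensional ℂ F] [T2Space B]
    (s : Cₛ^∞⟮𝓘(ℝ, EB); F, W⟯) :
    ContMDiffAt 𝓘(ℝ, EB) (𝓘(ℝ, EB).prod 𝓘(ℝ, F)) ∞
      (fun b => TotalSpace.mk' F b (M.sliceConn σ T (γ b) s b (w b))) b := by
  have : FiniteDimensional ℝ F := FiniteDimensional.complexToReal F
  have hP : ∀ s : Cₛ^∞⟮𝓘(ℝ, EB); F, W⟯, ContMDiff 𝓘(ℝ, EB) (𝓘(ℝ, EB).prod 𝓘(ℝ, F)) ∞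
      (fun x => TotalSpace.mk' F x ((M.hProj x).restrictScalars ℝ (s x))) :=
    fun s => M.hProj_smooth s s.contMDiff
  have h1 := M.contMDiffAt_sliceDeriv hσ hγ hγσ hw hT (M.hSec s)
  have h2 := M.contMDiffAt_sliceDeriv hσ hγ hγσ hw hT (s - M.hSec s)
  exact (contMDiffAt_fibrewise _ hP h1).add_section
    (h2.sub_section (contMDiffAt_fibrewise _ hP h2))

end SliceSmooth

/-! ### Equivariant horizontal connections near a point of `V` -/

section Horizontal

variable [IsManifold (𝓡 (n + m)) ∞ V] [IsManifold 𝓘(ℝ, EB) ∞ B] [VectorBundle ℂ F W]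
  [VectorBundle ℝ F W] [ContMDiffVectorBundle ∞ F W 𝓘(ℝ, EB)]

/-- An equivariant d-connection on `W` over `π⁻¹(U)` in the directions of an equivariant horizontal
lift of the tangent vectors of `V`. -/
structure HorizontalConnection (U : Set V) where
  lift : ∀ b : B, EuclideanSpace ℝ (Fin (n + m)) →ₗ[ℝ] TangentSpace 𝓘(ℝ, EB) b
  conn : Cₛ^∞⟮𝓘(ℝ, EB); F, W⟯ → ∀ b : B, EuclideanSpace ℝ (Fin (n + m)) →ₗ[ℝ] W b
  mfderiv_proj_lift : ∀ b, L.proj b ∈ U → ∀ Y,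
    mfderiv 𝓘(ℝ, EB) (𝓡 (n + m)) L.proj b (lift b Y) = Y
  lift_lact : ∀ g b, L.proj b ∈ U → ∀ Y,
    lift (L.lact g b) Y = mfderiv 𝓘(ℝ, EB) 𝓘(ℝ, EB) (L.lact g) b (lift b Y)
  lift_smooth : ∀ b, L.proj b ∈ U → ∀ w : B → EuclideanSpace ℝ (Fin (n + m)),
    ContMDiffAt 𝓘(ℝ, EB) ((𝓡 (n + m)).prod 𝓘(ℝ, EuclideanSpace ℝ (Fin (n + m)))) ∞
      (fun b => TotalSpace.mk' (EuclideanSpace ℝ (Fin (n + m)))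
        (E := (TangentSpace (𝓡 (n + m)) : V → Type _)) (L.proj b) (w b)) b →
    ContMDiffAt 𝓘(ℝ, EB) (𝓘(ℝ, EB).prod 𝓘(ℝ, EB)) ∞
      (fun b => TotalSpace.mk' EB (E := (TangentSpace 𝓘(ℝ, EB) : B → Type _)) b
        (lift b (w b))) b
  conn_add : ∀ s t b, L.proj b ∈ U → ∀ Y, conn (s + t) b Y = conn s b Y + conn t b Y
  conn_leibniz : ∀ (f : C^∞⟮𝓘(ℝ, EB), B; 𝓘(ℝ, ℂ), ℂ⟯) (s t : Cₛ^∞⟮𝓘(ℝ, EB); F, W⟯),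
    (∀ b, t b = f b • s b) → ∀ b, L.proj b ∈ U → ∀ Y,
      conn t b Y = cdiff f b (lift b Y) • s b + f b • conn s b Y
  conn_adapted : ∀ s t : Cₛ^∞⟮𝓘(ℝ, EB); F, W⟯, (∀ b, t b = M.hProj b (s b)) →
    ∀ b, L.proj b ∈ U → ∀ Y, conn t b Y = M.hProj b (conn s b Y)
  conn_equivariant : ∀ (c : Circle × Circle) (g : Gch × Gcv) (s t : Cₛ^∞⟮𝓘(ℝ, EB); F, W⟯),
    (∀ b, t (L.lact g b) = M.sharpAct c g b (s b)) →
    ∀ b, L.proj b ∈ U → ∀ Y, conn t (L.lact g b) Y = M.sharpAct c g b (conn s b Y)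
  conn_smooth : ∀ s b, L.proj b ∈ U → ∀ w : B → EuclideanSpace ℝ (Fin (n + m)),
    ContMDiffAt 𝓘(ℝ, EB) ((𝓡 (n + m)).prod 𝓘(ℝ, EuclideanSpace ℝ (Fin (n + m)))) ∞
      (fun b => TotalSpace.mk' (EuclideanSpace ℝ (Fin (n + m)))
        (E := (TangentSpace (𝓡 (n + m)) : V → Type _)) (L.proj b) (w b)) b →
    ContMDiffAt 𝓘(ℝ, EB) (𝓘(ℝ, EB).prod 𝓘(ℝ, F)) ∞
      (fun b => TotalSpace.mk' F b (conn s b (w b))) b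

variable [FiniteDimensional ℝ EB] [FiniteDimensional ℂ F] [T2Space B]
  [LieGroup 𝓘(ℝ, Eh) ∞ Gh] [LieGroup 𝓘(ℝ, Ev) ∞ Gv] [LieGroup 𝓘(ℝ, Eh) ∞ Gch]
  [LieGroup 𝓘(ℝ, Ev) ∞ Gcv]

/-- Two choices of group element are played against each other: an arbitrary total choice `κ`
defines the lift and derivative, and near each point a smooth choice `γ` proves them smooth. They
give the same result by the congruence lemmas, which also give equivariance. -/
theorem exists_horizontalConnection_nhds (x : V) :
    ∃ U : Set V, IsOpen U ∧ x ∈ U ∧ Nonempty (M.HorizontalConnection U) := by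
  obtain ⟨U₀, σ, hU₀, hx, hσ₀, hσp, hγ₀⟩ := L.exists_local_slice x
  let T := trivializationAt F W (σ x)
  have hU : IsOpen (U₀ ∩ σ ⁻¹' T.baseSet) :=
    hσ₀.continuousOn.isOpen_inter_preimage hU₀ T.open_baseSet
  refine ⟨U₀ ∩ σ ⁻¹' T.baseSet, hU, ⟨hx, mem_baseSet_trivializationAt F W (σ x)⟩, ?_⟩
  have hσ : ∀ b, L.proj b ∈ U₀ ∩ σ ⁻¹' T.baseSet →
      ContMDiffAt (𝓡 (n + m)) 𝓘(ℝ, EB) ∞ σ (L.proj b) :=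
    fun b hb => hσ₀.contMDiffAt (hU₀.mem_nhds hb.1)
  have hκ : ∀ b, ∃ g, L.proj b ∈ U₀ → L.lact g b = σ (L.proj b) := fun b => by
    by_cases hb : L.proj b ∈ U₀
    · obtain ⟨g, hg⟩ := L.exists_lact (hσp _ hb).symm
      exact ⟨g, fun _ => hg⟩
    · exact ⟨1, fun h => absurd h hb⟩
  choose κ hκ using hκ
  -- Both `κ (g · b) * g` and `κ b` carry `b` to the slice; comparing them is exactly equivariance.
  have hκ2 : ∀ g b, L.proj b ∈ U₀ → L.lact (κ (L.lact g b) * g) b = σ (L.proj b) := fun g b hb => by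
    rw [L.lact_mul, hκ _ (by rwa [L.proj_lact]), L.proj_lact]
  have hnear : ∀ b, L.proj b ∈ U₀ → ∀ᶠ b' in 𝓝 b, L.proj b' ∈ U₀ := fun b hb =>
    L.proj_smooth.continuous.continuousAt.eventually (hU₀.mem_nhds hb)
  exact ⟨{
    lift := fun b => (sliceLift L σ (κ b) b).toLinearMap
    conn := fun s b => M.sliceConn σ T (κ b) s b
    mfderiv_proj_lift := fun b hb Y => mfderiv_proj_sliceLift (hσ b hb)
      (eventually_of_mem (hU₀.mem_nhds hb.1) hσp) (hκ b hb.1) Y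
    lift_lact := fun g b hb Y => by
      refine (sliceLift_lact (κ (L.lact g b)) g (hσ b hb) (hκ2 g b hb.1) Y).trans ?_
      rw [sliceLift_congr σ ((hκ2 g b hb.1).trans (hκ b hb.1).symm)]
      rfl
    lift_smooth := fun b hb w hw => by
      obtain ⟨γ, hγ, hγσ⟩ := hγ₀ b hb.1
      refine (contMDiffAt_sliceLift (hσ b hb) hγ hγσ hw).congr_of_eventuallyEq ?_
      filter_upwards [hγσ, hnear b hb.1] with b' h1 h2
      rw [sliceLift_congr σ (h1.trans (hκ b' h2).symm)]
      rfl
    conn_add := fun s t b hb Y => M.sliceConn_add (hσ b hb) hb.2 (κ b) s t Y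
    conn_leibniz := fun f s t h b hb Y => by
      rw [show (t : ∀ b, W b) = fun b => f b • s b from funext h]
      exact M.sliceConn_fsmul (hσ b hb) hb.2 (hκ b hb.1) f.contMDiff s Y
    conn_adapted := fun s t h b hb Y => by
      rw [show (t : ∀ b, W b) = fun b => M.hProj b (s b) from funext h]
      exact M.sliceConn_hProj (hσ b hb) hb.2 (κ b) s Y
    conn_equivariant := fun c g s t h b hb Y => by
      rw [M.eq_transl (g := g) (s := fun b => M.scale c b (s b)) (t := t)
        (fun b => by rw [h, sharpAct_eq]), sliceConn_transl, M.sliceConn_scale (hσ b hb) hb.2,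
        sharpAct_eq, M.sliceConn_congr (hσ b hb) hb.2 ((hκ2 g b hb.1).trans (hκ b hb.1).symm)]
    conn_smooth := fun s b hb w hw => by
      obtain ⟨γ, hγ, hγσ⟩ := hγ₀ b hb.1
      refine (M.contMDiffAt_sliceConn (hσ b hb) hγ hγσ hw hb.2 s).congr_of_eventuallyEq ?_
      filter_upwards [hγσ, L.proj_smooth.continuous.continuousAt.eventually (hU.mem_nhds hb)]
        with b' h1 h2
      rw [M.sliceConn_congr (hσ b' h2) h2.2 (h1.trans (hκ b' h2.1).symm)] }⟩

end Horizontal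

/-! ### Gluing, existence of a module d-connection, and the N-splitting of forms -/

section Glue

variable [IsManifold (𝓡 (n + m)) ∞ V] [IsManifold 𝓘(ℝ, EB) ∞ B]

theorem _root_.DGerbe.LiftingGerbe.contMDiffAt_sum_partition
    (L : LiftingGerbe k n m V EB B Eh Ev Gh Gv Gch Gcv) {ι : Type*}
    (ρ : SmoothPartitionOfUnity ι (𝓡 (n + m)) V)
    {F' : Type*} [NormedAddCommGroup F'] [NormedSpace ℝ F']
    {W' : B → Type*} [∀ x, AddCommGroup (W' x)] [∀ x, Module ℝ (W' x)]
    [∀ x, TopologicalSpace (W' x)]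
    [TopologicalSpace (TotalSpace F' W')] [FiberBundle F' W'] [VectorBundle ℝ F' W']
    (t : ι → ∀ b, W' b) {b : B}
    (ht : ∀ i, L.proj b ∈ tsupport (ρ i) → ContMDiffAt 𝓘(ℝ, EB) (𝓘(ℝ, EB).prod 𝓘(ℝ, F')) ∞
      (fun b => TotalSpace.mk' F' b (t i b)) b) :
    ContMDiffAt 𝓘(ℝ, EB) (𝓘(ℝ, EB).prod 𝓘(ℝ, F')) ∞ (fun b => TotalSpace.mk' F' b
      (∑ i ∈ ρ.finsupport (L.proj b), ρ i (L.proj b) • t i b)) b := by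
  have hfin : LocallyFinite fun i => {b : B | ρ i (L.proj b) • t i b ≠ 0} :=
    (ρ.locallyFinite.preimage_continuous L.proj_smooth.continuous).subset
      fun i b hb h0 => hb (by simp [h0])
  have hsm : ∀ i, ContMDiffAt 𝓘(ℝ, EB) (𝓘(ℝ, EB).prod 𝓘(ℝ, F')) ∞
      (fun b => TotalSpace.mk' F' b (ρ i (L.proj b) • t i b)) b := fun i => by
    by_cases hb : L.proj b ∈ tsupport (ρ i)
    · exact (((ρ i).contMDiff.comp L.proj_smooth).contMDiffAt).smul_section (ht i hb)
    · refine (contMDiff_zeroSection ℝ W' b).congr_of_eventuallyEq ?_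
      filter_upwards [L.proj_smooth.continuous.continuousAt.eventually
        ((isClosed_tsupport (ρ i)).isOpen_compl.mem_nhds hb)] with b' hb'
      rw [image_eq_zero_of_notMem_tsupport hb', zero_smul]
      rfl
  refine (ContMDiffAt.finsum_section_of_locallyFinite hfin hsm).congr_of_eventuallyEq
    (Eventually.of_forall fun b => congrArg (TotalSpace.mk' F' b) ?_)
  exact ρ.sum_finsupport_smul_eq_finsum (x₀ := L.proj b) fun i _ => t i b

theorem cdiff_sum {ι : Type*} (S : Finset ι) (f : B → ℂ) (b : B) (r : ι → ℝ)
    (X : ι → TangentSpace 𝓘(ℝ, EB) b) :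
    cdiff f b (∑ i ∈ S, r i • X i) = ∑ i ∈ S, r i • cdiff f b (X i) := by
  have h := map_sum (mfderiv 𝓘(ℝ, EB) 𝓘(ℝ, ℂ) f b) (fun i => r i • X i) S
  simp only [map_smul] at h
  exact h

theorem cdiff_add (f : B → ℂ) (b : B) (X Y : TangentSpace 𝓘(ℝ, EB) b) :
    cdiff f b (X + Y) = cdiff f b X + cdiff f b Y :=
  map_add (mfderiv 𝓘(ℝ, EB) 𝓘(ℝ, ℂ) f b) X Y

variable [VectorBundle ℂ F W] [VectorBundle ℝ F W] [ContMDiffVectorBundle ∞ F W 𝓘(ℝ, EB)]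
  [FiniteDimensional ℝ EB] [FiniteDimensional ℂ F] [T2Space B] [T2Space V] [SigmaCompactSpace V]
  [LieGroup 𝓘(ℝ, Eh) ∞ Gh] [LieGroup 𝓘(ℝ, Ev) ∞ Gv] [LieGroup 𝓘(ℝ, Eh) ∞ Gch]
  [LieGroup 𝓘(ℝ, Ev) ∞ Gcv]

/-- The Leibniz rule is linear in the pair of `lift` and `conn`, the normalization of the lift
survives because the weights sum to one, and equivariance survives because they are functions on
`V`. -/
theorem nonempty_horizontalConnection : Nonempty (M.HorizontalConnection univ) := by
  choose U hU hxU hC using M.exists_horizontalConnection_nhds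
  let C := fun x => (hC x).some
  obtain ⟨ρ, hρ⟩ := SmoothPartitionOfUnity.exists_isSubordinate (𝓡 (n + m)) isClosed_univ U hU
    fun x _ => mem_iUnion.2 ⟨x, hxU x⟩
  have hmem : ∀ (b : B) (i : V), i ∈ ρ.finsupport (L.proj b) → L.proj b ∈ U i := fun b i hi =>
    hρ i (subset_tsupport _ ((ρ.mem_finsupport _).1 hi))
  let lift : ∀ b : B, EuclideanSpace ℝ (Fin (n + m)) →ₗ[ℝ] TangentSpace 𝓘(ℝ, EB) b := fun b =>
    ∑ i ∈ ρ.finsupport (L.proj b), ρ i (L.proj b) • (C i).lift b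
  let conn : Cₛ^∞⟮𝓘(ℝ, EB); F, W⟯ → ∀ b : B, EuclideanSpace ℝ (Fin (n + m)) →ₗ[ℝ] W b :=
    fun s b => ∑ i ∈ ρ.finsupport (L.proj b), ρ i (L.proj b) • (C i).conn s b
  have lift_apply : ∀ b Y, lift b Y =
      ∑ i ∈ ρ.finsupport (L.proj b), ρ i (L.proj b) • (C i).lift b Y := fun b Y => by
    simp [lift, LinearMap.sum_apply]
  have conn_apply : ∀ s b Y, conn s b Y =
      ∑ i ∈ ρ.finsupport (L.proj b), ρ i (L.proj b) • (C i).conn s b Y := fun s b Y => by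
    simp [conn, LinearMap.sum_apply]
  refine ⟨{
    lift := lift
    conn := conn
    mfderiv_proj_lift := fun b _ Y => ?_
    lift_lact := fun g b _ Y => ?_
    lift_smooth := fun b _ w hw => ?_
    conn_add := fun s t b _ Y => ?_
    conn_leibniz := fun f s t h b _ Y => ?_
    conn_adapted := fun s t h b _ Y => ?_
    conn_equivariant := fun c g s t h b _ Y => ?_
    conn_smooth := fun s b _ w hw => ?_ }⟩
  · rw [lift_apply, map_sum]
    have h : ∀ i ∈ ρ.finsupport (L.proj b), mfderiv 𝓘(ℝ, EB) (𝓡 (n + m)) L.proj b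
        (ρ i (L.proj b) • (C i).lift b Y) = ρ i (L.proj b) • Y := fun i hi => by
      rw [map_smul, (C i).mfderiv_proj_lift b (hmem b i hi)]
      rfl
    refine (Finset.sum_congr rfl h).trans ?_
    refine (Finset.sum_smul (s := ρ.finsupport (L.proj b)) (f := fun i => ρ i (L.proj b))
      (x := Y)).symm.trans ?_
    rw [ρ.sum_finsupport _ (mem_univ _), one_smul]
  · rw [lift_apply, lift_apply, map_sum, L.proj_lact]
    refine Finset.sum_congr rfl fun i hi => ?_
    rw [map_smul, (C i).lift_lact g b (hmem b i hi)]
  · simp only [lift_apply]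
    exact L.contMDiffAt_sum_partition ρ (fun i b => (C i).lift b (w b)) fun i hi =>
      (C i).lift_smooth b (hρ i hi) w hw
  · rw [conn_apply, conn_apply, conn_apply, ← Finset.sum_add_distrib]
    refine Finset.sum_congr rfl fun i hi => ?_
    rw [(C i).conn_add s t b (hmem b i hi), smul_add]
  · rw [conn_apply, conn_apply, lift_apply, cdiff_sum, Finset.sum_smul, Finset.smul_sum,
      ← Finset.sum_add_distrib]
    refine Finset.sum_congr rfl fun i hi => ?_
    rw [(C i).conn_leibniz f s t h b (hmem b i hi), smul_add, smul_assoc, smul_comm (f b)]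
  · rw [conn_apply, conn_apply, map_sum]
    refine Finset.sum_congr rfl fun i hi => ?_
    rw [(C i).conn_adapted s t h b (hmem b i hi), LinearMap.map_smul_of_tower]
  · rw [conn_apply, conn_apply, sharpAct_eq, map_sum, map_sum, L.proj_lact]
    refine Finset.sum_congr rfl fun i hi => ?_
    rw [(C i).conn_equivariant c g s t h b (hmem b i hi), sharpAct_eq,
      LinearMap.map_smul_of_tower]
    exact ((M.act g b).toLinearMap.map_smul_of_tower _ _).symm
  · simp only [conn_apply]
    exact L.contMDiffAt_sum_partition ρ (fun i b => (C i).conn s b (w b)) fun i hi =>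
      (C i).conn_smooth s b (hρ i hi) w hw

theorem contMDiff_mfderiv_proj (X : VField EB B) :
    ContMDiff 𝓘(ℝ, EB) ((𝓡 (n + m)).prod 𝓘(ℝ, EuclideanSpace ℝ (Fin (n + m)))) ∞
      (fun b => TotalSpace.mk' (EuclideanSpace ℝ (Fin (n + m)))
        (E := (TangentSpace (𝓡 (n + m)) : V → Type _)) (L.proj b)
        (mfderiv 𝓘(ℝ, EB) (𝓡 (n + m)) L.proj b (X b))) := fun b =>
  contMDiffAt_mfderiv_apply (f := fun _ : B => L.proj) (g := fun b : B => b)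
    (L.proj_smooth.contMDiffAt.comp (b, b) contMDiffAt_snd) (X.contMDiff b)

variable (L) in
/-- The differential of `B → V`, in the identification of tangent spaces of `V` with the model
space. -/
def projDeriv (b : B) : TangentSpace 𝓘(ℝ, EB) b →ₗ[ℝ] EuclideanSpace ℝ (Fin (n + m)) :=
  (mfderiv 𝓘(ℝ, EB) (𝓡 (n + m)) L.proj b).toLinearMap

theorem projDeriv_lact (g : Gch × Gcv) (b : B) (X : TangentSpace 𝓘(ℝ, EB) b) :
    projDeriv L (L.lact g b) (mfderiv 𝓘(ℝ, EB) 𝓘(ℝ, EB) (L.lact g) b X) = projDeriv L b X :=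
  L.mfderiv_proj_lact g b X

/-- Split a vector into its horizontal part, differentiated by `conn`, and the remainder tangent to
the fibre, differentiated by `D₀`. Equivariance of the lift makes the splitting invariant. -/
theorem nonempty_moduleDConnection (D₀ : M.FibreDConnection) :
    Nonempty (M.ModuleDConnection D₀) := by
  obtain ⟨C⟩ := M.nonempty_horizontalConnection
  have proj_lift : ∀ b Y, projDeriv L b (C.lift b Y) = Y := fun b =>
    C.mfderiv_proj_lift b (mem_univ _)
  let vert : ∀ b : B, TangentSpace 𝓘(ℝ, EB) b →ₗ[ℝ] FibreTangent L b := fun b =>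
    LinearMap.codRestrict (FibreTangent L b) (LinearMap.id - C.lift b ∘ₗ projDeriv L b)
      fun X => by
        change projDeriv L b (X - C.lift b (projDeriv L b X)) = 0
        rw [map_sub, proj_lift, sub_self]
  have vert_coe : ∀ b X, (vert b X : TangentSpace 𝓘(ℝ, EB) b) =
      X - C.lift b (projDeriv L b X) := fun b X => rfl
  let D : Cₛ^∞⟮𝓘(ℝ, EB); F, W⟯ → ∀ b : B, TangentSpace 𝓘(ℝ, EB) b →ₗ[ℝ] W b := fun s b =>
    C.conn s b ∘ₗ projDeriv L b + D₀.toFun s b ∘ₗ vert b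
  have D_apply : ∀ s b X, D s b X =
      C.conn s b (projDeriv L b X) + D₀.toFun s b (vert b X) :=
    fun s b X => rfl
  refine ⟨{
    toFun := D
    smooth := fun s X => ?_
    add := fun s t b X => ?_
    leibniz := fun f s t h b X => ?_
    adapted := fun s t h b X => ?_
    equivariant := fun c g s t h b X => ?_
    fibre := fun s b X => ?_ }⟩
  · have h1 : ContMDiff 𝓘(ℝ, EB) (𝓘(ℝ, EB).prod 𝓘(ℝ, EB)) ∞
        (fun b => TotalSpace.mk' EB (E := (TangentSpace 𝓘(ℝ, EB) : B → Type _)) b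
          (vert b (X b))) := fun b =>
      (X.contMDiff b).sub_section (C.lift_smooth b (mem_univ _) _ (contMDiff_mfderiv_proj X b))
    have h2 : SmoothSec EB F fun b => D₀.toFun s b (vert b (X b)) :=
      D₀.smooth s ⟨fun b => vert b (X b), h1⟩ fun b => (vert b (X b)).2
    exact fun b => ContMDiffAt.add_section
      (C.conn_smooth s b (mem_univ _) _ (contMDiff_mfderiv_proj X b)) (h2 b)
  · rw [D_apply, D_apply, D_apply, C.conn_add s t b (mem_univ _), D₀.add]
    abel
  · rw [D_apply, D_apply, C.conn_leibniz f s t h b (mem_univ _), D₀.leibniz f s t h, smul_add]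
    have hX : cdiff f b X = cdiff f b (C.lift b (projDeriv L b X)) +
        cdiff f b (vert b X).1 := by
      rw [← cdiff_add, vert_coe, add_sub_cancel]
    rw [hX, add_smul]
    abel
  · rw [D_apply, D_apply, C.conn_adapted s t h b (mem_univ _), D₀.adapted s t h, map_add]
  · have h1 := D₀.equivariant c g s t h b (vert b X)
      (vert (L.lact g b) (mfderiv 𝓘(ℝ, EB) 𝓘(ℝ, EB) (L.lact g) b X)) (by
        rw [vert_coe, vert_coe, projDeriv_lact, C.lift_lact g b (mem_univ _), map_sub])
    rw [D_apply, D_apply, h1, projDeriv_lact, C.conn_equivariant c g s t h b (mem_univ _),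
      sharpAct_eq, sharpAct_eq, sharpAct_eq, map_add, map_add]
  · have hX : projDeriv L b X.1 = 0 := X.2
    have hv : vert b X.1 = X := Subtype.ext (by rw [vert_coe, hX, map_zero, sub_zero])
    rw [D_apply, hX, hv, map_zero, zero_add]

/-- Smoothness is tested on fields on `B`. The horizontal lift of `N (dπ X)` is a smooth field `Z`,
and the pull-back of `θ ∘ N` at `X` is the pull-back of `θ` at `Z`. -/
theorem comp_mem_adForms (N : NConnection n m V) (θ : M.AdForms) :
    (fun x => θ.1 x ∘ₗ N.N x) ∈ M.AdForms := by
  obtain ⟨C⟩ := M.nonempty_horizontalConnection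
  intro X s
  let Z : VField EB B := ⟨fun b => C.lift b (N.N (L.proj b)
      (mfderiv 𝓘(ℝ, EB) (𝓡 (n + m)) L.proj b (X b))), fun b =>
    C.lift_smooth b (mem_univ _) _
      (contMDiffAt_fibrewise N.N N.smooth (contMDiff_mfderiv_proj X b))⟩
  have hZ : ∀ b, mfderiv 𝓘(ℝ, EB) (𝓡 (n + m)) L.proj b (Z b) =
      N.N (L.proj b) (mfderiv 𝓘(ℝ, EB) (𝓡 (n + m)) L.proj b (X b)) := fun b =>
    C.mfderiv_proj_lift b (mem_univ _) _
  have h := θ.2 Z s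
  simp only [pullback, hZ] at h
  exact h

theorem isCompl_hForms_vForms (N : NConnection n m V) : IsCompl (M.hForms N) (M.vForms N) := by
  refine ⟨Submodule.disjoint_def.2 fun θ hh hv => ?_,
    Submodule.codisjoint_iff_exists_add_eq.2 fun θ => ?_⟩
  · refine Subtype.ext (funext fun x => LinearMap.ext fun X => ?_)
    have h1 := hh x X
    -- Idempotence puts `X - N X` in `ker N`, where a vertical form vanishes; horizontality disposes
    -- of `N X`.
    have h2 := hv x (X - N.N x X) (by rw [map_sub, N.idem, sub_self])
    rw [map_sub, h1, sub_zero] at h2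
    exact h2
  · let θv : M.AdForms := ⟨_, M.comp_mem_adForms N θ⟩
    refine ⟨θ - θv, θv, fun x X => ?_, fun x X hX => ?_, sub_add_cancel θ θv⟩
    · change θ.1 x (N.N x X) - θ.1 x (N.N x (N.N x X)) = 0
      rw [N.idem, sub_self]
    · change θ.1 x (N.N x X) = 0
      rw [hX, map_zero]

end Glue

end PsiModule

end Main

end DGerbe

end

theorem mainTheorem10 {k n m : ℕ} [NeZero k] {V : Type*} [TopologicalSpace V]
    [ChartedSpace (EuclideanSpace ℝ (Fin (n + m))) V] [IsManifold (𝓡 (n + m)) ∞ V]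
    [T2Space V] [SigmaCompactSpace V]
    {EB : Type*} [NormedAddCommGroup EB] [NormedSpace ℝ EB] [FiniteDimensional ℝ EB]
    {B : Type*} [TopologicalSpace B] [ChartedSpace EB B] [IsManifold 𝓘(ℝ, EB) ∞ B] [T2Space B]
    {Eh : Type*} [NormedAddCommGroup Eh] [NormedSpace ℝ Eh] [FiniteDimensional ℝ Eh]
    {Ev : Type*} [NormedAddCommGroup Ev] [NormedSpace ℝ Ev] [FiniteDimensional ℝ Ev]
    {Gh Gv Gch Gcv : Type*}
    [Group Gh] [TopologicalSpace Gh] [ChartedSpace Eh Gh] [LieGroup 𝓘(ℝ, Eh) ∞ Gh]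
    [Group Gv] [TopologicalSpace Gv] [ChartedSpace Ev Gv] [LieGroup 𝓘(ℝ, Ev) ∞ Gv]
    [Group Gch] [TopologicalSpace Gch] [ChartedSpace Eh Gch] [LieGroup 𝓘(ℝ, Eh) ∞ Gch]
    [Group Gcv] [TopologicalSpace Gcv] [ChartedSpace Ev Gcv] [LieGroup 𝓘(ℝ, Ev) ∞ Gcv]
    {F : Type*} [NormedAddCommGroup F] [NormedSpace ℂ F] [FiniteDimensional ℂ F]
    {W : B → Type*} [∀ b, AddCommGroup (W b)] [∀ b, Module ℂ (W b)]
    [∀ b, TopologicalSpace (W b)] [TopologicalSpace (Bundle.TotalSpace F W)] [FiberBundle F W]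
    [VectorBundle ℂ F W] [VectorBundle ℝ F W] [ContMDiffVectorBundle ∞ F W 𝓘(ℝ, EB)]
    (N : DGerbe.NConnection n m V)
    (L : DGerbe.LiftingGerbe k n m V EB B Eh Ev Gh Gv Gch Gcv)
    (q : ℤ) (M : DGerbe.PsiModule F W L q) (D₀ : M.FibreDConnection) :
    (∃ _ : AddTorsor M.AdForms (M.ModuleDConnection D₀),
      ∀ (θ : M.AdForms) (D : M.ModuleDConnection D₀) s b X,
        (θ +ᵥ D).toFun s b X = D.toFun s b X + (M.pullback θ.1 b X).1 (s b)) ∧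
    IsCompl (M.hForms N) (M.vForms N) := by
  have := M.nonempty_moduleDConnection D₀
  exact ⟨⟨DGerbe.PsiModule.ModuleDConnection.addTorsor, fun θ D s b X => rfl⟩,
    M.isCompl_hForms_vForms N⟩
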